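/- Let $\mathbb I=\mathrm{diag}(d_1,d_2,d_3)$ with $d_1,d_2,d_3>0$, and let $e_S>0$. Suslov's problem on $SO(3)$ with control $\dot\xi$ is the system, for $\Omega,\xi\in\mathbb R^3$, $$q(\Omega,\xi):=\langle\xi,\mathbb I^{-1}\xi\rangle\,[\mathbb I\dot\Omega-(\mathbb I\Omega)\times\Omega]+[\langle\Omega,\dot\xi\rangle+\langle(\mathbb I\Omega)\times\Omega,\mathbb I^{-1}\xi\rangle]\,\xi=0 .$$ Let $$M=\{x=(\Omega,\xi)\in\mathbb R^6:\ \tfrac12\langle\mathbb I\Omega,\Omega\rangle=e_S,\ \langle\Omega,\xi\rangle=0,\ \xi\neq0\},$$ a $4$-dimensional embedded submanifold of $\mathbb R^6$. For $\xi\ne0$ the equation $q=0$ is equivalent to the affine control system $\dot x=f(x)+\sum_{i=1}^3u_i\,g_i(x)$ with $u=\dot\xi\in\mathbb R^3$, where $$f(x)=\Big(\tfrac{1}{\langle\xi,\mathbb I^{-1}\xi\rangle}\,\mathbb I^{-1}\big\{\langle\xi,\mathbb I^{-1}\xi\rangle\,(\mathbb I\Omega)\times\Omega-\langle(\mathbb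 I\Omega)\times\Omega,\mathbb I^{-1}\xi\rangle\,\xi\big\},\ 0\Big),\qquad g_i(x)=\Big(-\tfrac{\Omega_i}{\langle\xi,\mathbb I^{-1}\xi\rangle}\,\mathbb I^{-1}\xi,\ e_i\Big).$$ These fields are smooth on $\{\xi\neq0\}$ and tangent to $M$, and $M$ is taken as the state space. The accessibility distribution $C(x)$ is the span of the values at $x$ of all vector fields in the smallest Lie algebra of vector fields that contains $f,g_1,g_2,g_3$. Admissible controls are the piecewise smooth ones, or the piecewise analytic ones; the statements below hold for each of these two classes and for every initial time $a\in\mathbb R$. The system is *driftless* if $f\equiv0$ on $M$, and otherwise *has drift*. It is *controllable* if for all $x_a,x_b\in M$ there are a time $b\ge a$ and an admissible control on $[a,b]$ with a trajectory in $M$ from $x(a)=x_a$ to $x(b)=x_b$. It is *accessible* if for every $x_a\in M$ and every $b>a$, the set of all states reached from $x(a)=x_a$ at times $t\in[a,b]$ along trajectories in $M$ with admissible controls contains a nonempty open subset of $M$. **Theorem.** For every $x\in M$, $C(x)=T_xM$; in particular $\dim C(x)=4$. Moreover: 1. If $\mathbb I=cI_{3\times3}$ for some $c>0$, then the set of all $\Omega$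 with $(\Omega,\xi)\in M$ for some $\xi$ is the sphere of radius $\sqrt{2e_S/c}$ centred at $0$, $f=0$ at all points of $M$, and the system is driftless and controllable. 2. If $\mathbb I\neq cI_{3\times3}$ for all $c>0$, then the set of all $\Omega$ with $(\Omega,\xi)\in M$ for some $\xi$ is the ellipsoid $\{\tfrac12\langle\mathbb I\Omega,\Omega\rangle=e_S\}$, which is not a sphere; $f\neq0$ at most points of $M$, in the sense that $\{x\in M: f(x)\neq0\}$ is open and dense in $M$ and its complement in $M$ has $4$-dimensional Hausdorff measure zero; and the system has drift and is accessible. -/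

import Mathlib

open scoped ContDiff Matrix

noncomputable section

/-- An affine nonlinear control system `ẋ = f x + ∑ i, u i • g i x` with `k` scalar controls on the
embedded submanifold `M = {x ∈ domain | constraint x = 0}` of the normed space `E`, presented as the
zero set of a submersion. The vector fields are smooth on the open set `domain` and tangent to `M`. -/
structure AffineControlSystem (E F : Type*) [NormedAddCommGroup E] [NormedSpace ℝ E]
    [NormedAddCommGroup F] [NormedSpace ℝ F] (k : ℕ) where
  /-- an open set of the ambient space -/
  domain : Set E
  isOpen_domain : IsOpen domain
  /-- the state-space manifold is the zero set of this map in `domain` -/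
  constraint : E → F
  contDiffOn_constraint : ContDiffOn ℝ ∞ constraint domain
  submersion : ∀ x ∈ domain, constraint x = 0 →
    Function.Surjective (fderiv ℝ constraint x)
  /-- the drift vector field `f` -/
  drift : E → E
  contDiffOn_drift : ContDiffOn ℝ ∞ drift domain
  drift_tangent : ∀ x ∈ domain, constraint x = 0 → fderiv ℝ constraint x (drift x) = 0
  /-- the control vector fields `g i` -/
  control : Fin k → E → E
  contDiffOn_control : ∀ i, ContDiffOn ℝ ∞ (control i) domain
  control_tangent : ∀ i, ∀ x ∈ domain, constraint x = 0 → fderiv ℝ constraint x (control i x) = 0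

namespace AffineControlSystem

variable {E F : Type*} [NormedAddCommGroup E] [NormedSpace ℝ E]
  [NormedAddCommGroup F] [NormedSpace ℝ F] {k : ℕ}

/-- The state-space manifold `M`. -/
def state (S : AffineControlSystem E F k) : Set E :=
  {x | x ∈ S.domain ∧ S.constraint x = 0}

/-- The tangent space `T_x M`, as a subspace of the ambient space. -/
def tangentSpace (S : AffineControlSystem E F k) (x : E) : Submodule ℝ E :=
  LinearMap.ker (fderiv ℝ S.constraint x : E →ₗ[ℝ] F)

/-- The drift vanishes identically on `M`. -/
def IsDriftless (S : AffineControlSystem E F k) : Prop :=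
  ∀ x ∈ S.state, S.drift x = 0

/-- The system has drift if it is not driftless. -/
def HasDrift (S : AffineControlSystem E F k) : Prop := ¬ S.IsDriftless

/-- Membership in the accessibility algebra: the smallest real Lie algebra of vector fields that
contains the drift and the control vector fields. (All its members are smooth on the open set
`domain`, and are only ever evaluated there.) -/
inductive MemAccessibilityAlgebra (S : AffineControlSystem E F k) : (E → E) → Prop
  | drift : MemAccessibilityAlgebra S S.drift
  | control (i : Fin k) : MemAccessibilityAlgebra S (S.control i)
  | zero : MemAccessibilityAlgebra S 0
  | add {X Y : E → E} : MemAccessibilityAlgebra S X → MemAccessibilityAlgebra S Y →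
      MemAccessibilityAlgebra S (X + Y)
  | smul (c : ℝ) {X : E → E} : MemAccessibilityAlgebra S X → MemAccessibilityAlgebra S (c • X)
  | bracket {X Y : E → E} : MemAccessibilityAlgebra S X → MemAccessibilityAlgebra S Y →
      MemAccessibilityAlgebra S (VectorField.lieBracket ℝ X Y)

/-- The accessibility distribution `C(x)`: the span of the values at `x` of the vector fields in the
accessibility algebra. -/
def accessibilityDistribution (S : AffineControlSystem E F k) (x : E) : Submodule ℝ E :=
  Submodule.span ℝ {v | ∃ X, S.MemAccessibilityAlgebra X ∧ X x = v}

/-- `u` is piecewise of class `C^r` on `[a, b]`: there are `a = t 0 ≤ t 1 ≤ ⋯ ≤ t n = b` such that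
on each open interval `(t j, t (j + 1))` the map `u` agrees with a map that is of class `C^r` on the
closed interval. The classes in use are `r = ∞` (piecewise smooth) and `r = ω` (piecewise
analytic). -/
def IsAdmissible (r : WithTop ℕ∞) (a b : ℝ) (u : ℝ → Fin k → ℝ) : Prop :=
  ∃ (n : ℕ) (t : ℕ → ℝ), Monotone t ∧ t 0 = a ∧ t n = b ∧
    ∀ j < n, ∃ v : ℝ → Fin k → ℝ, ContDiffOn ℝ r v (Set.Icc (t j) (t (j + 1))) ∧
      Set.EqOn u v (Set.Ioo (t j) (t (j + 1)))

/-- `x` is a trajectory on `[a, b]`, for the control `u`: a continuous curve in the state-space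
manifold that satisfies the differential equation except at finitely many times. -/
def IsTrajectory (S : AffineControlSystem E F k) (a b : ℝ) (u : ℝ → Fin k → ℝ) (x : ℝ → E) : Prop :=
  ContinuousOn x (Set.Icc a b) ∧ (∀ t ∈ Set.Icc a b, x t ∈ S.state) ∧
    ∃ N : Finset ℝ, ∀ t ∈ Set.Ioo a b, t ∉ N →
      HasDerivAt x (S.drift (x t) + ∑ i, u t i • S.control i (x t)) t

/-- `R(x₀, t)`: the states that can be reached at time exactly `t` from `x₀` at time `a`. -/
def reachableAt (S : AffineControlSystem E F k) (r : WithTop ℕ∞) (a : ℝ) (x₀ : E) (t : ℝ) : Set E :=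
  {y | y ∈ S.state ∧ ∃ (u : ℝ → Fin k → ℝ) (x : ℝ → E), IsAdmissible r a t u ∧
    S.IsTrajectory a t u x ∧ x a = x₀ ∧ x t = y}

/-- `R_b(x₀)`: the union of the sets `R(x₀, t)` over `a ≤ t ≤ b`. -/
def reachableSet (S : AffineControlSystem E F k) (r : WithTop ℕ∞) (a : ℝ) (x₀ : E) (b : ℝ) : Set E :=
  ⋃ t ∈ Set.Icc a b, S.reachableAt r a x₀ t

/-- Controllability, with initial time `a` and controls that are piecewise of class `C^r`. -/
def IsControllable (S : AffineControlSystem E F k) (r : WithTop ℕ∞) (a : ℝ) : Prop :=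
  ∀ xa ∈ S.state, ∀ xb ∈ S.state, ∃ b, a ≤ b ∧
    ∃ (u : ℝ → Fin k → ℝ) (x : ℝ → E), IsAdmissible r a b u ∧
      S.IsTrajectory a b u x ∧ x a = xa ∧ x b = xb

/-- Accessibility from `xa`: for every `b > a` the reachable set `R_b(xa)` contains a nonempty
(relatively) open subset of the state-space manifold. -/
def IsAccessibleFrom (S : AffineControlSystem E F k) (r : WithTop ℕ∞) (a : ℝ) (xa : E) : Prop :=
  ∀ b, a < b → ∃ W : Set E, IsOpen W ∧ (W ∩ S.state).Nonempty ∧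
    W ∩ S.state ⊆ S.reachableSet r a xa b

/-- Accessibility from every state. -/
def IsAccessible (S : AffineControlSystem E F k) (r : WithTop ℕ∞) (a : ℝ) : Prop :=
  ∀ xa ∈ S.state, S.IsAccessibleFrom r a xa

end AffineControlSystem

namespace Suslov

/-- Vectors of `ℝ³` in the body frame. -/
abbrev Vec : Type := Fin 3 → ℝ

/-- The ambient space `ℝ⁶` of the states `x = (Ω, ξ)`. -/
abbrev Ambient : Type := Vec × Vec

/-- The inertia matrix `𝕀 = diag (d 0, d 1, d 2)`. -/
def inertia (d : Vec) : Matrix (Fin 3) (Fin 3) ℝ := Matrix.diagonal d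

/-- The kinetic energy `½ ⟨𝕀 Ω, Ω⟩`. -/
def energy (d Ω : Vec) : ℝ := 1 / 2 * ((inertia d *ᵥ Ω) ⬝ᵥ Ω)

/-- `⟨ξ, 𝕀⁻¹ ξ⟩`. -/
def invForm (d ξ : Vec) : ℝ := ξ ⬝ᵥ ((inertia d)⁻¹ *ᵥ ξ)

/-- `(𝕀 Ω) × Ω`. -/
def gyro (d Ω : Vec) : Vec := (inertia d *ᵥ Ω) ⨯₃ Ω

/-- The left-hand side `q` of Suslov's equations of motion `q = 0`, where `Ω'` and `ξ'` stand for the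
time derivatives of `Ω` and `ξ`. -/
def residual (d Ω Ω' ξ ξ' : Vec) : Vec :=
  invForm d ξ • (inertia d *ᵥ Ω' - gyro d Ω) +
    (Ω ⬝ᵥ ξ' + gyro d Ω ⬝ᵥ ((inertia d)⁻¹ *ᵥ ξ)) • ξ

/-- The drift vector field `f`. -/
def drift (d : Vec) (x : Ambient) : Ambient :=
  ((invForm d x.2)⁻¹ • ((inertia d)⁻¹ *ᵥ
    (invForm d x.2 • gyro d x.1 - (gyro d x.1 ⬝ᵥ ((inertia d)⁻¹ *ᵥ x.2)) • x.2)), 0)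

/-- The control vector fields `g i`. -/
def control (d : Vec) (i : Fin 3) (x : Ambient) : Ambient :=
  (-((invForm d x.2)⁻¹ • ((inertia d)⁻¹ *ᵥ (x.1 i • x.2))), Pi.single i 1)

/-- The map `Φ (Ω, ξ) = (½ ⟨𝕀 Ω, Ω⟩ - e_S, ⟨Ω, ξ⟩)`. -/
def constraint (d : Vec) (eS : ℝ) (x : Ambient) : ℝ × ℝ :=
  (energy d x.1 - eS, x.1 ⬝ᵥ x.2)

theorem inertia_inv {d : Vec} (hd : ∀ i, 0 < d i) :
    (inertia d)⁻¹ = Matrix.diagonal (fun i => (d i)⁻¹) := by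
  refine Matrix.inv_eq_left_inv ?_
  rw [inertia, Matrix.diagonal_mul_diagonal, ← Matrix.diagonal_one]
  congr 1
  funext i
  exact inv_mul_cancel₀ (hd i).ne'

theorem invForm_eq {d : Vec} (hd : ∀ i, 0 < d i) (ξ : Vec) :
    invForm d ξ = ξ 0 * ((d 0)⁻¹ * ξ 0) + ξ 1 * ((d 1)⁻¹ * ξ 1) + ξ 2 * ((d 2)⁻¹ * ξ 2) := by
  simp [invForm, inertia_inv hd, dotProduct, Matrix.mulVec_diagonal, Fin.sum_univ_three]

theorem invForm_pos {d : Vec} (hd : ∀ i, 0 < d i) {ξ : Vec} (hξ : ξ ≠ 0) : 0 < invForm d ξ := by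
  have h : ∀ i, 0 ≤ ξ i * ((d i)⁻¹ * ξ i) := fun i => by
    have := (inv_pos.2 (hd i)).le
    nlinarith [mul_nonneg this (mul_self_nonneg (ξ i))]
  obtain ⟨i, hi⟩ := Function.ne_iff.1 hξ
  have hi' : 0 < ξ i * ((d i)⁻¹ * ξ i) := by
    have := mul_pos (inv_pos.2 (hd i)) (mul_self_pos.2 hi)
    nlinarith
  have e : invForm d ξ = ∑ i, ξ i * ((d i)⁻¹ * ξ i) := by
    rw [invForm_eq hd, Fin.sum_univ_three]
  rw [e]
  exact Finset.sum_pos' (fun i _ => h i) ⟨i, Finset.mem_univ i, hi'⟩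

theorem hasFDerivAt_fst_apply (i : Fin 3) (x : Ambient) :
    HasFDerivAt (fun y : Ambient => y.1 i)
      ((ContinuousLinearMap.proj i : Vec →L[ℝ] ℝ).comp (ContinuousLinearMap.fst ℝ Vec Vec)) x :=
  ((ContinuousLinearMap.proj i : Vec →L[ℝ] ℝ).comp
    (ContinuousLinearMap.fst ℝ Vec Vec)).hasFDerivAt

theorem hasFDerivAt_snd_apply (i : Fin 3) (x : Ambient) :
    HasFDerivAt (fun y : Ambient => y.2 i)
      ((ContinuousLinearMap.proj i : Vec →L[ℝ] ℝ).comp (ContinuousLinearMap.snd ℝ Vec Vec)) x :=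
  ((ContinuousLinearMap.proj i : Vec →L[ℝ] ℝ).comp
    (ContinuousLinearMap.snd ℝ Vec Vec)).hasFDerivAt

theorem constraint_eq (d : Vec) (eS : ℝ) : constraint d eS = fun x : Ambient =>
    (1 / 2 * (d 0 * x.1 0 * x.1 0 + d 1 * x.1 1 * x.1 1 + d 2 * x.1 2 * x.1 2) - eS,
      x.1 0 * x.2 0 + x.1 1 * x.2 1 + x.1 2 * x.2 2) := by
  funext x
  simp [constraint, energy, inertia, dotProduct, Matrix.mulVec_diagonal, Fin.sum_univ_three]

theorem contDiff_constraint (d : Vec) (eS : ℝ) : ContDiff ℝ ∞ (constraint d eS) := by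
  rw [constraint_eq]
  fun_prop

theorem fderiv_constraint (d : Vec) (eS : ℝ) (x v : Ambient) :
    fderiv ℝ (constraint d eS) x v =
      (d 0 * x.1 0 * v.1 0 + d 1 * x.1 1 * v.1 1 + d 2 * x.1 2 * v.1 2,
        x.2 0 * v.1 0 + x.2 1 * v.1 1 + x.2 2 * v.1 2 +
          (x.1 0 * v.2 0 + x.1 1 * v.2 1 + x.1 2 * v.2 2)) := by
  have a := fun i => hasFDerivAt_fst_apply i x
  have b := fun i => hasFDerivAt_snd_apply i x
  have h1 := ((((((a 0).const_mul (d 0)).mul (a 0)).add (((a 1).const_mul (d 1)).mul (a 1))).add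
    (((a 2).const_mul (d 2)).mul (a 2))).const_mul (1 / 2)).sub_const eS
  have h2 := (((a 0).mul (b 0)).add ((a 1).mul (b 1))).add ((a 2).mul (b 2))
  have h := h1.prodMk h2
  rw [constraint_eq]
  erw [h.fderiv]
  ext
  · simp
    ring
  · simp
    ring

theorem mulVec_inertia (d v : Vec) (i : Fin 3) : (inertia d *ᵥ v) i = d i * v i := by
  simp [inertia, Matrix.mulVec_diagonal]

theorem mulVec_inertia_inv {d : Vec} (hd : ∀ i, 0 < d i) (v : Vec) (i : Fin 3) :
    ((inertia d)⁻¹ *ᵥ v) i = (d i)⁻¹ * v i := by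
  simp [inertia_inv hd, Matrix.mulVec_diagonal]

theorem gyro_eq (d Ω : Vec) : gyro d Ω =
    ![d 1 * Ω 1 * Ω 2 - d 2 * Ω 2 * Ω 1, d 2 * Ω 2 * Ω 0 - d 0 * Ω 0 * Ω 2,
      d 0 * Ω 0 * Ω 1 - d 1 * Ω 1 * Ω 0] := by
  simp [gyro, cross_apply, mulVec_inertia]

theorem contDiff_invForm {d : Vec} (hd : ∀ i, 0 < d i) :
    ContDiff ℝ ∞ (fun x : Ambient => invForm d x.2) := by
  simp only [invForm_eq hd]
  fun_prop

theorem contDiffOn_drift {d : Vec} (hd : ∀ i, 0 < d i) :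
    ContDiffOn ℝ ∞ (drift d) {x | x.2 ≠ 0} := by
  have hs : ContDiffOn ℝ ∞ (fun x : Ambient => (invForm d x.2)⁻¹) {x | x.2 ≠ 0} :=
    (contDiff_invForm hd).contDiffOn.inv fun x hx => (invForm_pos hd hx).ne'
  have hq := (contDiff_invForm hd).contDiffOn (s := {x : Ambient | x.2 ≠ 0})
  refine ContDiffOn.prodMk ?_ contDiffOn_const
  refine contDiffOn_pi.2 fun i => ?_
  simp only [Pi.smul_apply, smul_eq_mul, mulVec_inertia_inv hd, Pi.sub_apply, dotProduct,
    Fin.sum_univ_three, gyro_eq]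
  refine hs.mul (contDiffOn_const.mul (ContDiffOn.sub (hq.mul ?_) ?_)) <;>
    fin_cases i <;> simp <;> fun_prop

theorem contDiffOn_control {d : Vec} (hd : ∀ i, 0 < d i) (j : Fin 3) :
    ContDiffOn ℝ ∞ (control d j) {x | x.2 ≠ 0} := by
  have hs : ContDiffOn ℝ ∞ (fun x : Ambient => (invForm d x.2)⁻¹) {x | x.2 ≠ 0} :=
    (contDiff_invForm hd).contDiffOn.inv fun x hx => (invForm_pos hd hx).ne'
  refine ContDiffOn.prodMk ?_ contDiffOn_const
  refine contDiffOn_pi.2 fun i => ?_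
  simp only [Pi.neg_apply, Pi.smul_apply, smul_eq_mul, mulVec_inertia_inv hd]
  refine (hs.mul ?_).neg
  fun_prop

theorem drift_tangent {d : Vec} (hd : ∀ i, 0 < d i) (eS : ℝ) (x : Ambient) (hx : x.2 ≠ 0)
    (h : constraint d eS x = 0) : fderiv ℝ (constraint d eS) x (drift d x) = 0 := by
  have hq := (invForm_pos hd hx).ne'
  have h0 := (hd 0).ne'
  have h1 := (hd 1).ne'
  have h2 := (hd 2).ne'
  have hc : x.1 0 * x.2 0 + x.1 1 * x.2 1 + x.1 2 * x.2 2 = 0 := by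
    rw [constraint_eq] at h
    exact congrArg Prod.snd h
  rw [fderiv_constraint]
  set q := invForm d x.2 with hqd
  have hqe := invForm_eq hd x.2
  rw [← hqd] at hqe
  set p := gyro d x.1 ⬝ᵥ ((inertia d)⁻¹ *ᵥ x.2) with hp
  have hpe : p = (d 1 * x.1 1 * x.1 2 - d 2 * x.1 2 * x.1 1) * ((d 0)⁻¹ * x.2 0) +
      (d 2 * x.1 2 * x.1 0 - d 0 * x.1 0 * x.1 2) * ((d 1)⁻¹ * x.2 1) +
      (d 0 * x.1 0 * x.1 1 - d 1 * x.1 1 * x.1 0) * ((d 2)⁻¹ * x.2 2) := by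
    simp [hp, dotProduct, Fin.sum_univ_three, gyro_eq, mulVec_inertia_inv hd]
  have e : ∀ i, (drift d x).1 i = (d i)⁻¹ * (gyro d x.1 i) - p / q * ((d i)⁻¹ * x.2 i) := by
    intro i
    simp only [drift, ← hqd, ← hp, Pi.smul_apply, smul_eq_mul, mulVec_inertia_inv hd, Pi.sub_apply]
    field_simp
  have e2 : ∀ i, (drift d x).2 i = 0 := fun i => rfl
  rw [e, e, e, e2, e2, e2, gyro_eq]
  ext
  · simp
    field_simp
    linear_combination (-p) * hc
  · simp
    have : p / q * q = p := div_mul_cancel₀ p hq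
    linear_combination (-1 : ℝ) * hpe + (p / q) * hqe - this

theorem control_tangent {d : Vec} (hd : ∀ i, 0 < d i) (eS : ℝ) (j : Fin 3) (x : Ambient)
    (hx : x.2 ≠ 0) (h : constraint d eS x = 0) :
    fderiv ℝ (constraint d eS) x (control d j x) = 0 := by
  have hq := (invForm_pos hd hx).ne'
  have h0 := (hd 0).ne'
  have h1 := (hd 1).ne'
  have h2 := (hd 2).ne'
  have hc : x.1 0 * x.2 0 + x.1 1 * x.2 1 + x.1 2 * x.2 2 = 0 := by
    rw [constraint_eq] at h
    exact congrArg Prod.snd h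
  rw [fderiv_constraint]
  set q := invForm d x.2 with hqd
  have hqe := invForm_eq hd x.2
  rw [← hqd] at hqe
  have e : ∀ i, (control d j x).1 i = -(x.1 j * q⁻¹) * ((d i)⁻¹ * x.2 i) := by
    intro i
    simp only [control, ← hqd, Pi.neg_apply, Pi.smul_apply, smul_eq_mul, mulVec_inertia_inv hd]
    ring
  have e2 : x.1 0 * (control d j x).2 0 + x.1 1 * (control d j x).2 1 +
      x.1 2 * (control d j x).2 2 = x.1 j := by
    fin_cases j <;> simp [control]
  rw [e2, e, e, e]
  have hqq : q⁻¹ * q = 1 := inv_mul_cancel₀ hq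
  ext
  · simp
    field_simp
    linear_combination (-x.1 j) * hc
  · simp
    linear_combination (x.1 j * q⁻¹) * hqe - x.1 j * hqq

theorem constraint_submersion {d : Vec} {eS : ℝ} (heS : 0 < eS) (x : Ambient)
    (h : constraint d eS x = 0) : Function.Surjective (fderiv ℝ (constraint d eS) x) := by
  have hn : x.1 ≠ 0 := by
    intro h0
    rw [constraint_eq] at h
    have := congrArg Prod.fst h
    simp [h0] at this
    linarith
  have hE : d 0 * x.1 0 * x.1 0 + d 1 * x.1 1 * x.1 1 + d 2 * x.1 2 * x.1 2 = 2 * eS := by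
    rw [constraint_eq] at h
    have := congrArg Prod.fst h
    simp at this
    linarith
  have hN : x.1 0 * x.1 0 + x.1 1 * x.1 1 + x.1 2 * x.1 2 ≠ 0 := by
    intro h0
    refine hn (funext fun i => ?_)
    have e0 : x.1 0 = 0 := by nlinarith [mul_self_nonneg (x.1 1), mul_self_nonneg (x.1 2)]
    have e1 : x.1 1 = 0 := by nlinarith [mul_self_nonneg (x.1 0), mul_self_nonneg (x.1 2)]
    have e2 : x.1 2 = 0 := by nlinarith [mul_self_nonneg (x.1 0), mul_self_nonneg (x.1 1)]
    fin_cases i <;> simp [e0, e1, e2]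
  set n := x.1 0 * x.1 0 + x.1 1 * x.1 1 + x.1 2 * x.1 2 with hnd
  set m := x.2 0 * x.1 0 + x.2 1 * x.1 1 + x.2 2 * x.1 2 with hm
  rintro ⟨s, t⟩
  have hk : ((t - s / (2 * eS) * m) / n) * n = t - s / (2 * eS) * m := div_mul_cancel₀ _ hN
  have hs : s / (2 * eS) * (2 * eS) = s := div_mul_cancel₀ _ (by positivity)
  refine ⟨((s / (2 * eS)) • x.1, ((t - s / (2 * eS) * m) / n) • x.1), ?_⟩
  rw [fderiv_constraint]
  ext
  · simp only [Pi.smul_apply, smul_eq_mul]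
    linear_combination (s / (2 * eS)) * hE + hs
  · simp only [Pi.smul_apply, smul_eq_mul]
    linear_combination hk - ((t - s / (2 * eS) * m) / n) * hnd - (s / (2 * eS)) * hm

/-- Suslov's system with state `(Ω, ξ)` and control `u = ξ'`, on the manifold
`M = {(Ω, ξ) | ½ ⟨𝕀 Ω, Ω⟩ = e_S, ⟨Ω, ξ⟩ = 0, ξ ≠ 0}`. -/
def system (d : Vec) (hd : ∀ i, 0 < d i) (eS : ℝ) (heS : 0 < eS) :
    AffineControlSystem Ambient (ℝ × ℝ) 3 where
  domain := {x | x.2 ≠ 0}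
  isOpen_domain := isOpen_ne_fun continuous_snd continuous_const
  constraint := constraint d eS
  contDiffOn_constraint := (contDiff_constraint d eS).contDiffOn
  submersion := fun x _ h => constraint_submersion heS x h
  drift := drift d
  contDiffOn_drift := contDiffOn_drift hd
  drift_tangent := drift_tangent hd eS
  control := control d
  contDiffOn_control := contDiffOn_control hd
  control_tangent := control_tangent hd eS

/-- The set of all angular velocities `Ω` of states in `M`, as a subset of Euclidean space. -/
def velocities (d : Vec) (hd : ∀ i, 0 < d i) (eS : ℝ) (heS : 0 < eS) :
    Set (EuclideanSpace ℝ (Fin 3)) :=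
  (fun x : Ambient => WithLp.toLp 2 x.1) '' (system d hd eS heS).state

end Suslov

end

/-! Write G = (𝕀Ω) × Ω and q = ⟨ξ, 𝕀⁻¹ξ⟩.

Distribution. Solving the equations of motion for Ω' gives f and the g_i. Each of these fields
annihilates ⟨Ω, ξ⟩ and changes the energy at a rate that is a smooth multiple of ⟨Ω, ξ⟩. Unlike bare
tangency along M, this condition (`IsTangent`) passes to ambient Lie brackets by a one-line
computation, so C(x) ⊆ T_xM, which has dimension 6 - 2 = 4. Conversely the g_i are independent
because their ξ-components are the standard basis, and a combination of their brackets
(`verticalBracket`) has zero ξ-component but nonzero Ω-component. That makes four independent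
directions.

Zeros of f. The drift vanishes exactly when G is a multiple of ξ. If d_i ≠ d_j, then either G = 0,
which forces Ω_i Ω_j = 0, or ξ is a multiple of G. These alternatives are covered by three C¹ images
of ℝ³, hence are null for 4-dimensional Hausdorff measure. Density comes from explicit perturbations
of Ω and ξ.

Steering. Both control statements rest on `exists_trajectory_of_velocity`: any analytic curve Ω on
the energy ellipsoid with 𝕀Ω' - G ≠ 0 is the velocity part of a trajectory, with ξ = 𝕀Ω' - G. A
state therefore corresponds to a position and a tangent velocity on the ellipsoid, and steering
becomes the problem of joining such first-order data by curves. When 𝕀 = c I, great circles join any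
two velocities, and ξ can be moved freely with Ω held fixed because there is no drift. In general,
cubic Hermite curves in ℝ³ projected radially to the ellipsoid reach a neighbourhood of a nearby
state. Accessibility is thus proved directly, not deduced from the rank of C(x). -/

noncomputable section

namespace Suslov

open Set Filter Topology

/-! ### Coordinate formulas -/

/-- `⟨(𝕀 Ω) × Ω, 𝕀⁻¹ ξ⟩`. -/
def gyroForm (d : Vec) (x : Ambient) : ℝ := gyro d x.1 ⬝ᵥ ((inertia d)⁻¹ *ᵥ x.2)

theorem dot_eq (v w : Vec) : v ⬝ᵥ w = v 0 * w 0 + v 1 * w 1 + v 2 * w 2 := by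
  simp [dotProduct, Fin.sum_univ_three]

theorem gyroForm_eq {d : Vec} (hd : ∀ i, 0 < d i) (x : Ambient) :
    gyroForm d x = (d 1 * x.1 1 * x.1 2 - d 2 * x.1 2 * x.1 1) * ((d 0)⁻¹ * x.2 0) +
      (d 2 * x.1 2 * x.1 0 - d 0 * x.1 0 * x.1 2) * ((d 1)⁻¹ * x.2 1) +
      (d 0 * x.1 0 * x.1 1 - d 1 * x.1 1 * x.1 0) * ((d 2)⁻¹ * x.2 2) := by
  rw [gyroForm, dot_eq]
  simp only [mulVec_inertia_inv hd, gyro_eq]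
  simp

theorem contDiff_gyroForm {d : Vec} (hd : ∀ i, 0 < d i) : ContDiff ℝ ∞ (gyroForm d) := by
  rw [funext (gyroForm_eq hd)]
  fun_prop

theorem drift_fst_apply {d : Vec} (hd : ∀ i, 0 < d i) {x : Ambient} (hx : x.2 ≠ 0) (i : Fin 3) :
    (drift d x).1 i =
      (d i)⁻¹ * gyro d x.1 i - gyroForm d x * (invForm d x.2)⁻¹ * ((d i)⁻¹ * x.2 i) := by
  have hq := (invForm_pos hd hx).ne'
  simp only [drift, Pi.smul_apply, smul_eq_mul, mulVec_inertia_inv hd, Pi.sub_apply]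
  rw [← gyroForm]
  field_simp

theorem control_fst_apply {d : Vec} (hd : ∀ i, 0 < d i) (j : Fin 3) (x : Ambient) (i : Fin 3) :
    (control d j x).1 i = -(x.1 j * (invForm d x.2)⁻¹) * ((d i)⁻¹ * x.2 i) := by
  simp only [control, Pi.neg_apply, Pi.smul_apply, smul_eq_mul, mulVec_inertia_inv hd]
  ring

theorem control_snd (d : Vec) (j : Fin 3) (x : Ambient) :
    (control d j x).2 = Pi.single j 1 := rfl

theorem sum_control_fst_apply {d : Vec} (hd : ∀ i, 0 < d i) (u : Vec) (x : Ambient) (i : Fin 3) :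
    (∑ j, u j • control d j x).1 i =
      -((x.1 ⬝ᵥ u) * (invForm d x.2)⁻¹) * ((d i)⁻¹ * x.2 i) := by
  rw [Fin.sum_univ_three, dot_eq]
  simp only [Prod.fst_add, Prod.smul_fst, Pi.add_apply, Pi.smul_apply, smul_eq_mul,
    control_fst_apply hd]
  ring

theorem sum_control_snd (d u : Vec) (x : Ambient) :
    (∑ j, u j • control d j x).2 = u := by
  rw [Prod.snd_sum]
  funext i
  fin_cases i <;> simp [control_snd, Fin.sum_univ_three]

/-- Component i of q(Ω, ξ) is ⟨ξ, 𝕀⁻¹ξ⟩ d_i, a nonzero factor, times the difference between Ω'_i and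
the Ω-component of the control system. -/
theorem residual_eq_zero_iff {d : Vec} (hd : ∀ i, 0 < d i) (Ω Ω' ξ ξ' : Vec) (hξ : ξ ≠ 0) :
    residual d Ω Ω' ξ ξ' = 0 ↔
      (Ω', ξ') = drift d (Ω, ξ) + ∑ i, ξ' i • control d i (Ω, ξ) := by
  have hq := (invForm_pos hd hξ).ne'
  have h2 : (drift d (Ω, ξ) + ∑ i, ξ' i • control d i (Ω, ξ)).2 = ξ' := by
    rw [Prod.snd_add, sum_control_snd]
    exact zero_add _
  rw [Prod.ext_iff]
  simp only [h2, and_true]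
  rw [funext_iff, funext_iff]
  refine forall_congr' fun i => ?_
  have hi := (hd i).ne'
  rw [Prod.fst_add, Pi.add_apply, drift_fst_apply hd hξ, sum_control_fst_apply hd]
  have e : residual d Ω Ω' ξ ξ' i = invForm d ξ * (d i * Ω' i - gyro d Ω i) +
      (Ω ⬝ᵥ ξ' + gyroForm d (Ω, ξ)) * ξ i := by
    simp [residual, gyroForm, mulVec_inertia]
  rw [e, Pi.zero_apply]
  dsimp only
  rw [← sub_eq_zero (a := Ω' i)]
  have : invForm d ξ * (d i * Ω' i - gyro d Ω i) + (Ω ⬝ᵥ ξ' + gyroForm d (Ω, ξ)) * ξ i =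
      (invForm d ξ * d i) * (Ω' i - ((d i)⁻¹ * gyro d Ω i -
        gyroForm d (Ω, ξ) * (invForm d ξ)⁻¹ * ((d i)⁻¹ * ξ i) +
        -((Ω ⬝ᵥ ξ') * (invForm d ξ)⁻¹) * ((d i)⁻¹ * ξ i))) := by
    field_simp
    ring
  rw [this, mul_eq_zero, or_iff_right (mul_ne_zero hq hi)]

/-! ### The state space -/

theorem mem_state_iff {d : Vec} {hd : ∀ i, 0 < d i} {eS : ℝ} {heS : 0 < eS} {x : Ambient} :
    x ∈ (system d hd eS heS).state ↔ x.2 ≠ 0 ∧ energy d x.1 = eS ∧ x.1 ⬝ᵥ x.2 = 0 := by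
  change x.2 ≠ 0 ∧ (energy d x.1 - eS, x.1 ⬝ᵥ x.2) = 0 ↔ _
  rw [Prod.ext_iff]
  simp [sub_eq_zero]

theorem energy_eq (d Ω : Vec) :
    energy d Ω = 1 / 2 * (d 0 * Ω 0 * Ω 0 + d 1 * Ω 1 * Ω 1 + d 2 * Ω 2 * Ω 2) := by
  simp [energy, dot_eq, mulVec_inertia]

theorem dot_self_eq_zero_iff {v : Vec} : v ⬝ᵥ v = 0 ↔ v = 0 := dotProduct_self_eq_zero

theorem energy_pos {d : Vec} (hd : ∀ i, 0 < d i) {Ω : Vec} (h : Ω ≠ 0) : 0 < energy d Ω := by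
  obtain ⟨i, hi⟩ := Function.ne_iff.1 h
  have key : energy d Ω = ∑ i, 1 / 2 * (d i * (Ω i * Ω i)) := by
    rw [energy_eq, Fin.sum_univ_three]
    ring
  rw [key]
  refine Finset.sum_pos' (fun j _ => ?_) ⟨i, Finset.mem_univ i, ?_⟩
  · have := hd j
    have := mul_self_nonneg (Ω j)
    positivity
  · have := hd i
    have := mul_self_pos.2 hi
    positivity

theorem ne_zero_of_energy {d : Vec} {eS : ℝ} (heS : 0 < eS) {Ω : Vec} (h : energy d Ω = eS) :
    Ω ≠ 0 := by
  rintro rfl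
  simp [energy] at h
  exact heS.ne h

/-! ### The accessibility distribution -/

/-- A smooth vector field on `{ξ ≠ 0}` that annihilates `⟨Ω, ξ⟩` and maps the energy to a smooth
multiple of `⟨Ω, ξ⟩`. -/
def IsTangent (d : Vec) (eS : ℝ) (X : Ambient → Ambient) : Prop :=
  ContDiffOn ℝ ∞ X {x | x.2 ≠ 0} ∧ ∃ h : Ambient → ℝ, ContDiffOn ℝ ∞ h {x | x.2 ≠ 0} ∧
    ∀ x : Ambient, x.2 ≠ 0 → fderiv ℝ (constraint d eS) x (X x) = (h x * (constraint d eS x).2, 0)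

theorem isOpen_snd_ne_zero : IsOpen {x : Ambient | x.2 ≠ 0} :=
  isOpen_ne_fun continuous_snd continuous_const

/-- Leibniz rule for h ⟨Ω, ξ⟩: a direction that kills ⟨Ω, ξ⟩ only sees the derivative of h, so the
factor ⟨Ω, ξ⟩ survives. -/
theorem IsTangent.fderiv_fderiv {d : Vec} {eS : ℝ} {X : Ambient → Ambient}
    {h : Ambient → ℝ} (hh : ContDiffOn ℝ ∞ h {x | x.2 ≠ 0})
    (hX : ∀ x : Ambient, x.2 ≠ 0 →
      fderiv ℝ (constraint d eS) x (X x) = (h x * (constraint d eS x).2, 0))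
    {x v : Ambient} (hx : x.2 ≠ 0) (hv : (fderiv ℝ (constraint d eS) x v).2 = 0) :
    fderiv ℝ (fun y => fderiv ℝ (constraint d eS) y (X y)) x v =
      (fderiv ℝ h x v * (constraint d eS x).2, 0) := by
  have hU := isOpen_snd_ne_zero.mem_nhds hx
  have e : (fun y => fderiv ℝ (constraint d eS) y (X y)) =ᶠ[𝓝 x]
      fun y => (h y * (constraint d eS y).2, 0) :=
    Filter.eventually_of_mem hU fun y hy => hX y hy
  have h1 : HasFDerivAt h (fderiv ℝ h x) x :=
    ((hh.contDiffAt hU).differentiableAt (by simp)).hasFDerivAt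
  have h2 : HasFDerivAt (constraint d eS) (fderiv ℝ (constraint d eS) x) x :=
    ((contDiff_constraint d eS).contDiffAt.differentiableAt (by simp)).hasFDerivAt
  have h3 := (h1.mul h2.snd).prodMk (hasFDerivAt_const (0 : ℝ) x)
  rw [e.fderiv_eq]
  erw [h3.fderiv]
  ext
  · simp [hv]
    ring
  · simp

/-- The bracket acts on functions as the commutator XY - YX. If f and g are the multipliers of X and
Y, the multiplier of [X, Y] is X g - Y f, because X and Y both annihilate ⟨Ω, ξ⟩. -/
theorem IsTangent.lieBracket {d : Vec} {eS : ℝ} {X Y : Ambient → Ambient}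
    (hX : IsTangent d eS X) (hY : IsTangent d eS Y) :
    IsTangent d eS (VectorField.lieBracket ℝ X Y) := by
  obtain ⟨sX, f, sf, hf⟩ := hX
  obtain ⟨sY, g, sg, hg⟩ := hY
  have hU := isOpen_snd_ne_zero
  have sfd : ∀ {φ : Ambient → ℝ} {Z : Ambient → Ambient}, ContDiffOn ℝ ∞ φ {x | x.2 ≠ 0} →
      ContDiffOn ℝ ∞ Z {x | x.2 ≠ 0} →
      ContDiffOn ℝ ∞ (fun x => fderiv ℝ φ x (Z x)) {x | x.2 ≠ 0} := fun hφ hZ =>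
    (hφ.fderiv_of_isOpen hU (by simp)).clm_apply hZ
  refine ⟨fun x hx => ?_, fun x => fderiv ℝ g x (X x) - fderiv ℝ f x (Y x),
    (sfd sg sX).sub (sfd sf sY), fun x hx => ?_⟩
  · exact ((sX.contDiffAt (hU.mem_nhds hx)).lieBracket_vectorField
      (sY.contDiffAt (hU.mem_nhds hx)) (by simp)).contDiffWithinAt
  · have dX := (sX.contDiffAt (hU.mem_nhds hx)).differentiableAt (by simp)
    have dY := (sY.contDiffAt (hU.mem_nhds hx)).differentiableAt (by simp)
    rw [VectorField.fderiv_apply_lieBracket (n := ∞) (contDiff_constraint d eS).contDiffAt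
      (by simp [minSmoothness_of_isRCLikeNormedField]; exact WithTop.coe_le_coe.2 le_top) dY dX,
      IsTangent.fderiv_fderiv sg hg hx (by rw [hf x hx]),
      IsTangent.fderiv_fderiv sf hf hx (by rw [hg x hx])]
    ext
    · simp
      ring
    · simp

theorem contDiffOn_inv_invForm {d : Vec} (hd : ∀ i, 0 < d i) :
    ContDiffOn ℝ ∞ (fun x : Ambient => (invForm d x.2)⁻¹) {x | x.2 ≠ 0} :=
  (contDiff_invForm hd).contDiffOn.inv fun _ hx => (invForm_pos hd hx).ne'

/-- Since (𝕀Ω) × Ω is orthogonal to Ω, the energy rate along f is only the contribution of the ξ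
term, -(`gyroForm`/`invForm`) ⟨Ω, ξ⟩. The coefficient of that term is what cancels the rate of ⟨Ω,
ξ⟩. -/
theorem isTangent_drift {d : Vec} (hd : ∀ i, 0 < d i) (eS : ℝ) : IsTangent d eS (drift d) := by
  refine ⟨contDiffOn_drift hd, fun x => -(gyroForm d x * (invForm d x.2)⁻¹),
    ((contDiff_gyroForm hd).contDiffOn.mul (contDiffOn_inv_invForm hd)).neg, fun x hx => ?_⟩
  have hq := inv_mul_cancel₀ (invForm_pos hd hx).ne'
  rw [fderiv_constraint, constraint_eq]
  simp only [drift_fst_apply hd hx]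
  have e2 : (drift d x).2 = 0 := rfl
  have h0 := mul_inv_cancel₀ (hd 0).ne'
  have h1 := mul_inv_cancel₀ (hd 1).ne'
  have h2 := mul_inv_cancel₀ (hd 2).ne'
  generalize hr : (invForm d x.2)⁻¹ = r at *
  rw [gyro_eq, e2]
  ext
  · simp
    generalize gyroForm d x = p
    generalize (d 0)⁻¹ = D0 at *
    generalize (d 1)⁻¹ = D1 at *
    generalize (d 2)⁻¹ = D2 at *
    linear_combination
      (x.1 0 * (d 1 * x.1 1 * x.1 2 - d 2 * x.1 2 * x.1 1 - p * r * x.2 0)) * h0 +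
      (x.1 1 * (d 2 * x.1 2 * x.1 0 - d 0 * x.1 0 * x.1 2 - p * r * x.2 1)) * h1 +
      (x.1 2 * (d 0 * x.1 0 * x.1 1 - d 1 * x.1 1 * x.1 0 - p * r * x.2 2)) * h2
  · simp
    rw [invForm_eq hd] at hq
    linear_combination (-1 : ℝ) * gyroForm_eq hd x - gyroForm d x * hq

theorem isTangent_control {d : Vec} (hd : ∀ i, 0 < d i) (eS : ℝ) (j : Fin 3) :
    IsTangent d eS (control d j) := by
  refine ⟨contDiffOn_control hd j, fun x => -(x.1 j * (invForm d x.2)⁻¹),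
    (ContDiffOn.mul (by fun_prop) (contDiffOn_inv_invForm hd)).neg, fun x hx => ?_⟩
  have hq := inv_mul_cancel₀ (invForm_pos hd hx).ne'
  rw [fderiv_constraint, constraint_eq]
  simp only [control_fst_apply hd]
  have e2 : x.1 0 * (control d j x).2 0 + x.1 1 * (control d j x).2 1 +
      x.1 2 * (control d j x).2 2 = x.1 j := by
    fin_cases j <;> simp [control]
  have h0 := mul_inv_cancel₀ (hd 0).ne'
  have h1 := mul_inv_cancel₀ (hd 1).ne'
  have h2 := mul_inv_cancel₀ (hd 2).ne'
  rw [e2]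
  generalize hr : (invForm d x.2)⁻¹ = r at *
  ext
  · linear_combination (-x.1 j * r * x.1 0 * x.2 0) * h0 + (-x.1 j * r * x.1 1 * x.2 1) * h1 +
      (-x.1 j * r * x.1 2 * x.2 2) * h2
  · rw [invForm_eq hd] at hq
    linear_combination (-x.1 j) * hq

theorem isTangent_of_mem {d : Vec} {hd : ∀ i, 0 < d i} {eS : ℝ} {heS : 0 < eS}
    {X : Ambient → Ambient} (h : (system d hd eS heS).MemAccessibilityAlgebra X) :
    IsTangent d eS X := by
  induction h with
  | drift => exact isTangent_drift hd eS
  | control i => exact isTangent_control hd eS i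
  | zero => exact ⟨contDiffOn_const, 0, contDiffOn_const, fun x _ => by simp; rfl⟩
  | add _ _ hX hY =>
    obtain ⟨sX, f, sf, hf⟩ := hX
    obtain ⟨sY, g, sg, hg⟩ := hY
    refine ⟨sX.add sY, f + g, sf.add sg, fun x hx => ?_⟩
    rw [Pi.add_apply, map_add, hf x hx, hg x hx]
    ext <;> simp
    ring
  | smul c _ hX =>
    obtain ⟨sX, f, sf, hf⟩ := hX
    refine ⟨contDiffOn_const.smul sX, c • f, contDiffOn_const.smul sf, fun x hx => ?_⟩
    rw [Pi.smul_apply, map_smul, hf x hx]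
    ext <;> simp
    ring
  | bracket _ _ hX hY => exact hX.lieBracket hY

theorem accessibilityDistribution_le {d : Vec} {hd : ∀ i, 0 < d i} {eS : ℝ} {heS : 0 < eS}
    {x : Ambient} (hx : x ∈ (system d hd eS heS).state) :
    (system d hd eS heS).accessibilityDistribution x ≤ (system d hd eS heS).tangentSpace x := by
  refine Submodule.span_le.2 ?_
  rintro _ ⟨X, hX, rfl⟩
  obtain ⟨-, h, -, hh⟩ := isTangent_of_mem hX
  change fderiv ℝ (constraint d eS) x (X x) = 0
  have h0 : (constraint d eS x).2 = 0 := by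
    rw [show constraint d eS x = 0 from hx.2]
    rfl
  rw [hh x hx.1, h0, mul_zero]
  rfl

theorem finrank_tangentSpace {d : Vec} {hd : ∀ i, 0 < d i} {eS : ℝ} {heS : 0 < eS}
    {x : Ambient} (hx : x ∈ (system d hd eS heS).state) :
    Module.finrank ℝ ((system d hd eS heS).tangentSpace x) = 4 := by
  have hs := (system d hd eS heS).submersion x hx.1 hx.2
  have h := LinearMap.finrank_range_add_finrank_ker
    (fderiv ℝ (system d hd eS heS).constraint x : Ambient →ₗ[ℝ] ℝ × ℝ)
  have hr : LinearMap.range (fderiv ℝ (system d hd eS heS).constraint x : Ambient →ₗ[ℝ] ℝ × ℝ) = ⊤ :=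
    LinearMap.range_eq_top.2 hs
  rw [hr, finrank_top] at h
  simp only [Module.finrank_prod, Module.finrank_self, Module.finrank_fin_fun] at h
  unfold AffineControlSystem.tangentSpace
  omega

/-! ### Brackets of the control fields and the lower bound for the distribution. -/

theorem hasFDerivAt_invForm_snd {d : Vec} (hd : ∀ i, 0 < d i) (x : Ambient) :
    ∃ L : Ambient →L[ℝ] ℝ, HasFDerivAt (fun y : Ambient => invForm d y.2) L x ∧
      ∀ v : Ambient, L v = 2 * ((d 0)⁻¹ * x.2 0 * v.2 0 + (d 1)⁻¹ * x.2 1 * v.2 1 +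
        (d 2)⁻¹ * x.2 2 * v.2 2) := by
  have b := fun i => hasFDerivAt_snd_apply i x
  have h := (((b 0).mul ((b 0).const_mul (d 0)⁻¹)).add ((b 1).mul ((b 1).const_mul (d 1)⁻¹))).add
    ((b 2).mul ((b 2).const_mul (d 2)⁻¹))
  simp only [invForm_eq hd]
  refine ⟨_, h, fun v => ?_⟩
  simp
  ring

theorem fderiv_control_fst {d : Vec} (hd : ∀ i, 0 < d i) (j : Fin 3) {x : Ambient} (hx : x.2 ≠ 0)
    (v : Ambient) (l : Fin 3) :
    (fderiv ℝ (control d j) x v).1 l =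
      -(v.1 j * (invForm d x.2)⁻¹ - x.1 j * ((invForm d x.2)⁻¹ * (invForm d x.2)⁻¹ *
        (2 * ((d 0)⁻¹ * x.2 0 * v.2 0 + (d 1)⁻¹ * x.2 1 * v.2 1 + (d 2)⁻¹ * x.2 2 * v.2 2)))) *
        ((d l)⁻¹ * x.2 l) - x.1 j * (invForm d x.2)⁻¹ * ((d l)⁻¹ * v.2 l) := by
  have hq := (invForm_pos hd hx).ne'
  obtain ⟨L, hL, eL⟩ := hasFDerivAt_invForm_snd hd x
  have h1 := (((hasFDerivAt_fst_apply j x).mul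
    ((hasDerivAt_inv hq).comp_hasFDerivAt x hL)).neg).mul
    ((hasFDerivAt_snd_apply l x).const_mul (d l)⁻¹)
  have h2 := ((contDiffOn_control hd j).contDiffAt (isOpen_snd_ne_zero.mem_nhds hx)).differentiableAt
    (by simp) |>.hasFDerivAt
  have h3 := ((ContinuousLinearMap.proj l : Vec →L[ℝ] ℝ).comp
    (ContinuousLinearMap.fst ℝ Vec Vec)).hasFDerivAt.comp x h2
  have e : (⇑((ContinuousLinearMap.proj l : Vec →L[ℝ] ℝ).comp
      (ContinuousLinearMap.fst ℝ Vec Vec)) ∘ control d j) =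
      fun y => -(y.1 j * (invForm d y.2)⁻¹) * ((d l)⁻¹ * y.2 l) :=
    funext fun y => control_fst_apply hd j y l
  rw [e] at h3
  have h4 := congrArg (fun A : Ambient →L[ℝ] ℝ => A v) (h3.unique h1)
  simp only [ContinuousLinearMap.comp_apply, ContinuousLinearMap.proj_apply,
    ContinuousLinearMap.coe_fst'] at h4
  rw [h4]
  simp [eL, -neg_add_rev]
  field_simp
  ring

theorem fderiv_control_snd {d : Vec} (hd : ∀ i, 0 < d i) (j : Fin 3) {x : Ambient} (hx : x.2 ≠ 0)
    (v : Ambient) : (fderiv ℝ (control d j) x v).2 = 0 := by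
  have h2 := ((contDiffOn_control hd j).contDiffAt (isOpen_snd_ne_zero.mem_nhds hx)).differentiableAt
    (by simp) |>.hasFDerivAt
  have h3 := (ContinuousLinearMap.snd ℝ Vec Vec).hasFDerivAt.comp x h2
  have h4 := h3.unique (hasFDerivAt_const (Pi.single j 1 : Vec) x)
  exact congrArg (fun A : Ambient →L[ℝ] Vec => A v) h4

theorem lieBracket_control_snd {d : Vec} (hd : ∀ i, 0 < d i) (i j : Fin 3) {x : Ambient}
    (hx : x.2 ≠ 0) : (VectorField.lieBracket ℝ (control d i) (control d j) x).2 = 0 := by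
  rw [VectorField.lieBracket_eq, Prod.snd_sub, fderiv_control_snd hd j hx,
    fderiv_control_snd hd i hx, sub_zero]

theorem lieBracket_control_fst {d : Vec} (hd : ∀ i, 0 < d i) (i j l : Fin 3) {x : Ambient}
    (hx : x.2 ≠ 0) : (VectorField.lieBracket ℝ (control d i) (control d j) x).1 l =
      (invForm d x.2)⁻¹ * (invForm d x.2)⁻¹ *
        (x.1 j * ((d i)⁻¹ * x.2 i) - x.1 i * ((d j)⁻¹ * x.2 j)) * ((d l)⁻¹ * x.2 l) +
      (invForm d x.2)⁻¹ * (d l)⁻¹ *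
        (x.1 i * (Pi.single j 1 : Vec) l - x.1 j * (Pi.single i 1 : Vec) l) := by
  have key : ∀ k : Fin 3, (d 0)⁻¹ * x.2 0 * (Pi.single k 1 : Vec) 0 +
      (d 1)⁻¹ * x.2 1 * (Pi.single k 1 : Vec) 1 + (d 2)⁻¹ * x.2 2 * (Pi.single k 1 : Vec) 2 =
      (d k)⁻¹ * x.2 k := by
    intro k
    fin_cases k <;> simp
  rw [VectorField.lieBracket_eq, Prod.fst_sub, Pi.sub_apply, fderiv_control_fst hd j hx,
    fderiv_control_fst hd i hx]
  simp only [control_fst_apply hd, control_snd, key]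
  ring

/-- A vertical vector in the span of the brackets of the control vector fields. -/
def verticalBracket (d : Vec) (x : Ambient) : Ambient :=
  x.2 0 • VectorField.lieBracket ℝ (control d 1) (control d 2) x +
    x.2 1 • VectorField.lieBracket ℝ (control d 2) (control d 0) x +
    x.2 2 • VectorField.lieBracket ℝ (control d 0) (control d 1) x

theorem verticalBracket_snd {d : Vec} (hd : ∀ i, 0 < d i) {x : Ambient} (hx : x.2 ≠ 0) :
    (verticalBracket d x).2 = 0 := by
  simp [verticalBracket, lieBracket_control_snd hd _ _ hx]

/-- With m = ξ × Ω and q = ⟨ξ, 𝕀⁻¹ξ⟩, the Ω-component is q⁻¹ 𝕀⁻¹(m - q⁻¹ ⟨m, 𝕀⁻¹ξ⟩ ξ). Pairing it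
with 𝕀m removes the second term, as m ⊥ ξ, and leaves q⁻¹|m|² = q⁻¹|Ω|²|ξ|², which is nonzero
because Ω ⊥ ξ. -/
theorem verticalBracket_ne_zero {d : Vec} (hd : ∀ i, 0 < d i) {x : Ambient} (hx : x.2 ≠ 0)
    (hx1 : x.1 ≠ 0) (hxx : x.1 ⬝ᵥ x.2 = 0) : verticalBracket d x ≠ 0 := by
  intro h0
  have hw : ∀ l, (verticalBracket d x).1 l = 0 := fun l => by rw [h0]; rfl
  have c0 := hw 0
  have c1 := hw 1
  have c2 := hw 2
  simp only [verticalBracket, Prod.fst_add, Prod.smul_fst, Pi.add_apply, Pi.smul_apply,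
    smul_eq_mul, lieBracket_control_fst hd _ _ _ hx] at c0 c1 c2
  simp at c0 c1 c2
  have hr := inv_pos.2 (invForm_pos hd hx)
  have h1 := dot_self_eq_zero_iff.not.2 hx1
  have h2 := dot_self_eq_zero_iff.not.2 hx
  rw [dot_eq] at h1 h2 hxx
  have e0 := mul_inv_cancel₀ (hd 0).ne'
  have e1 := mul_inv_cancel₀ (hd 1).ne'
  have e2 := mul_inv_cancel₀ (hd 2).ne'
  generalize (invForm d x.2)⁻¹ = r at *
  have hne := mul_ne_zero hr.ne' (mul_ne_zero h1 h2)
  refine hne ?_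
  generalize (d 0)⁻¹ = D0 at *
  generalize (d 1)⁻¹ = D1 at *
  generalize (d 2)⁻¹ = D2 at *
  generalize x.1 0 = a0 at *
  generalize x.1 1 = a1 at *
  generalize x.1 2 = a2 at *
  generalize x.2 0 = b0 at *
  generalize x.2 1 = b1 at *
  generalize x.2 2 = b2 at *
  -- m is the cross product ξ × Ω, and p below is ⟨m, 𝕀⁻¹ξ⟩.
  obtain ⟨m0, hm0⟩ : ∃ m, m = b1 * a2 - b2 * a1 := ⟨_, rfl⟩
  obtain ⟨m1, hm1⟩ : ∃ m, m = b2 * a0 - b0 * a2 := ⟨_, rfl⟩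
  obtain ⟨m2, hm2⟩ : ∃ m, m = b0 * a1 - b1 * a0 := ⟨_, rfl⟩
  obtain ⟨p, hp⟩ : ∃ p, p = m0 * (D0 * b0) + m1 * (D1 * b1) + m2 * (D2 * b2) := ⟨_, rfl⟩
  have k0 : r * D0 * m0 - r * r * p * (D0 * b0) = 0 := by
    rw [hp, hm0, hm1, hm2]; linear_combination c0
  have k1 : r * D1 * m1 - r * r * p * (D1 * b1) = 0 := by
    rw [hp, hm0, hm1, hm2]; linear_combination c1
  have k2 : r * D2 * m2 - r * r * p * (D2 * b2) = 0 := by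
    rw [hp, hm0, hm1, hm2]; linear_combination c2
  have hmb : m0 * b0 + m1 * b1 + m2 * b2 = 0 := by rw [hm0, hm1, hm2]; ring
  have hmm : m0 * m0 + m1 * m1 + m2 * m2 =
      (a0 * a0 + a1 * a1 + a2 * a2) * (b0 * b0 + b1 * b1 + b2 * b2) := by
    rw [hm0, hm1, hm2]
    linear_combination (-(a0 * b0 + a1 * b1 + a2 * b2)) * hxx
  rw [← hmm]
  linear_combination d 0 * m0 * k0 + d 1 * m1 * k1 + d 2 * m2 * k2 + r * r * p * hmb +
    (r * r * p * b0 - r * m0) * m0 * e0 + (r * r * p * b1 - r * m1) * m1 * e1 +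
    (r * r * p * b2 - r * m2) * m2 * e2

theorem four_le_finrank_accessibilityDistribution {d : Vec} {hd : ∀ i, 0 < d i} {eS : ℝ}
    {heS : 0 < eS} {x : Ambient} (hx : x ∈ (system d hd eS heS).state) :
    4 ≤ Module.finrank ℝ ((system d hd eS heS).accessibilityDistribution x) := by
  obtain ⟨h2, he, hxx⟩ := mem_state_iff.1 hx
  have hw := verticalBracket_ne_zero hd h2 (ne_zero_of_energy heS he) hxx
  have hw2 := verticalBracket_snd hd h2
  -- The ξ-components are 0, e_0, e_1, e_2: a vanishing combination first loses its control
  -- coefficients, then the remaining one.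
  let b : Fin 4 → Ambient := Fin.cons (verticalBracket d x) fun i => control d i x
  have hb : LinearIndependent ℝ b := by
    rw [Fintype.linearIndependent_iff]
    intro c hc
    rw [Fin.sum_univ_succ] at hc
    simp only [b, Fin.cons_zero, Fin.cons_succ] at hc
    have hc2 := congrArg Prod.snd hc
    rw [Prod.snd_add, Prod.smul_snd, hw2, smul_zero, zero_add,
      sum_control_snd d (fun i => c i.succ)] at hc2
    have hs : ∀ i : Fin 3, c i.succ = 0 := fun i => congrFun hc2 i
    simp only [hs, zero_smul, Finset.sum_const_zero, add_zero] at hc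
    exact Fin.cases ((smul_eq_zero.1 hc).resolve_right hw) hs
  have hle : Submodule.span ℝ (Set.range b) ≤
      (system d hd eS heS).accessibilityDistribution x := by
    have hm : ∀ {X}, (system d hd eS heS).MemAccessibilityAlgebra X →
        X x ∈ (system d hd eS heS).accessibilityDistribution x :=
      fun h => Submodule.subset_span ⟨_, h, rfl⟩
    have hg : ∀ i, (system d hd eS heS).MemAccessibilityAlgebra (control d i) := fun i =>
      .control i
    rw [Submodule.span_le]
    rintro _ ⟨i, rfl⟩
    refine Fin.cases ?_ (fun i => hm (hg i)) i
    exact add_mem (add_mem (Submodule.smul_mem _ _ (hm (.bracket (hg 1) (hg 2))))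
      (Submodule.smul_mem _ _ (hm (.bracket (hg 2) (hg 0)))))
      (Submodule.smul_mem _ _ (hm (.bracket (hg 0) (hg 1))))
  simpa [finrank_span_eq_card hb] using Submodule.finrank_mono hle

theorem accessibilityDistribution_eq {d : Vec} {hd : ∀ i, 0 < d i} {eS : ℝ} {heS : 0 < eS}
    {x : Ambient} (hx : x ∈ (system d hd eS heS).state) :
    (system d hd eS heS).accessibilityDistribution x = (system d hd eS heS).tangentSpace x :=
  Submodule.eq_of_le_of_finrank_le (accessibilityDistribution_le hx)
    ((finrank_tangentSpace hx).le.trans (four_le_finrank_accessibilityDistribution hx))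

end Suslov

end

noncomputable section

namespace Suslov

open Set Filter Topology

/-! ### The set of angular velocities -/

theorem exists_orthogonal_ne_zero (Ω : Vec) : ∃ ξ : Vec, ξ ≠ 0 ∧ Ω ⬝ᵥ ξ = 0 := by
  by_cases h : Ω 0 = 0
  · exact ⟨Pi.single 0 1, by simp, by simp [h]⟩
  · refine ⟨![-Ω 1, Ω 0, 0], fun h0 => h (by simpa using congrFun h0 1), ?_⟩
    rw [dot_eq]
    simp
    ring

theorem velocities_eq (d : Vec) (hd : ∀ i, 0 < d i) (eS : ℝ) (heS : 0 < eS) :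
    velocities d hd eS heS = {v | energy d v.ofLp = eS} := by
  ext v
  constructor
  · rintro ⟨x, hx, rfl⟩
    exact (mem_state_iff.1 hx).2.1
  · intro hv
    obtain ⟨ξ, hξ, h⟩ := exists_orthogonal_ne_zero v.ofLp
    exact ⟨(v.ofLp, ξ), mem_state_iff.2 ⟨hξ, hv, h⟩, rfl⟩

theorem inertia_eq_smul_one_iff {d : Vec} {c : ℝ} :
    inertia d = c • (1 : Matrix (Fin 3) (Fin 3) ℝ) ↔ ∀ i, d i = c := by
  rw [inertia, ← Matrix.diagonal_one, ← Matrix.diagonal_smul, Matrix.diagonal_eq_diagonal_iff]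
  simp

theorem velocities_eq_sphere {d : Vec} (hd : ∀ i, 0 < d i) {eS : ℝ} (heS : 0 < eS) {c : ℝ}
    (hc : 0 < c) (h : ∀ i, d i = c) :
    velocities d hd eS heS = Metric.sphere 0 (Real.sqrt (2 * eS / c)) := by
  rw [velocities_eq]
  ext v
  rw [mem_sphere_zero_iff_norm, EuclideanSpace.norm_eq, Real.sqrt_inj (by positivity)
    (by positivity), mem_ofPred_eq, energy_eq, Fin.sum_univ_three, eq_div_iff hc.ne']
  simp only [h, Real.norm_eq_abs, sq_abs]
  constructor <;> intro h1
  · linear_combination 2 * h1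
  · linear_combination h1 / 2

/-- The ellipsoid contains the points ±r_i e_i with r_i² = 2 e_S / d_i. Being equidistant from both
signs puts the centre at 0, and then all r_i² equal ρ². -/
theorem eq_of_velocities_eq_sphere {d : Vec} (hd : ∀ i, 0 < d i) {eS : ℝ} (heS : 0 < eS)
    {p : EuclideanSpace ℝ (Fin 3)} {ρ : ℝ}
    (h : velocities d hd eS heS = Metric.sphere p ρ) (i j : Fin 3) : d i = d j := by
  rw [velocities_eq] at h
  set r : Fin 3 → ℝ := fun i => Real.sqrt (2 * eS / d i) with hr
  have hr0 : ∀ i, 0 < r i := fun i => Real.sqrt_pos.2 (div_pos (by positivity) (hd i))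
  have hr2 : ∀ i, r i * r i * d i = 2 * eS := fun i => by
    rw [Real.mul_self_sqrt (div_pos (by positivity) (hd i)).le, div_mul_cancel₀ _ (hd i).ne']
  -- The squared distance from p to s r_i e_i, with s = ±1.
  have hm : ∀ (i : Fin 3) (s : ℝ), s * s = 1 →
      (p 0 * p 0 + p 1 * p 1 + p 2 * p 2) - 2 * s * r i * p i + r i * r i = ρ ^ 2 := by
    intro i s hs
    have hv : WithLp.toLp 2 (Pi.single i (s * r i) : Vec) ∈
        {v : EuclideanSpace ℝ (Fin 3) | energy d v.ofLp = eS} := by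
      rw [mem_ofPred_eq, energy_eq]
      have e := hr2 i
      fin_cases i <;> simp at e ⊢ <;> linear_combination (1 / 2 * s * s) * e + eS * hs
    rw [h, Metric.mem_sphere, EuclideanSpace.dist_eq] at hv
    rw [← hv, Real.sq_sqrt (by positivity), Fin.sum_univ_three]
    simp only [Real.dist_eq, sq_abs]
    fin_cases i <;> simp <;> linear_combination (-r _ ^ 2) * hs
  have hp : ∀ i, p i = 0 := fun i => by
    have h1 := hm i 1 (by norm_num)
    have h2 := hm i (-1) (by norm_num)
    have : r i * p i = 0 := by linear_combination (h2 - h1) / 4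
    exact (mul_eq_zero.1 this).resolve_left (hr0 i).ne'
  have hrr : ∀ i, r i * r i = ρ ^ 2 := fun i => by
    have := hm i 1 (by norm_num)
    simpa [hp] using this
  have e1 := hr2 i
  have e2 := hr2 j
  have hne : ρ ^ 2 ≠ 0 := by rw [← hrr i]; exact (mul_pos (hr0 i) (hr0 i)).ne'
  rw [hrr] at e1 e2
  exact mul_left_cancel₀ hne (e1.trans e2.symm)

theorem drift_eq_zero_of_eq {d : Vec} {c : ℝ} (h : ∀ i, d i = c) (x : Ambient) :
    drift d x = 0 := by
  have hg : gyro d x.1 = 0 := by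
    rw [gyro_eq]
    funext i
    fin_cases i <;> simp [h] <;> ring
  simp [drift, hg]

theorem exists_ne_of_inertia_ne {d : Vec} (hd : ∀ i, 0 < d i)
    (h : ∀ c : ℝ, 0 < c → inertia d ≠ c • (1 : Matrix (Fin 3) (Fin 3) ℝ)) :
    ∃ i j, d i ≠ d j := by
  by_contra! hc
  exact h (d 0) (hd 0) (inertia_eq_smul_one_iff.2 fun i => hc i 0)

/-! ### The zero set of the drift -/

/-- Up to sign, the components of (𝕀Ω) × Ω are the products (d_i - d_j) Ω_i Ω_j. -/
theorem mul_eq_zero_of_gyro_eq_zero {d Ω : Vec} (h : gyro d Ω = 0) {i j : Fin 3}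
    (hij : d i ≠ d j) : Ω i * Ω j = 0 := by
  rw [gyro_eq] at h
  have h0 := congrFun h 0
  have h1 := congrFun h 1
  have h2 := congrFun h 2
  simp at h0 h1 h2
  have key : (d i - d j) * (Ω i * Ω j) = 0 := by
    fin_cases i <;> fin_cases j <;> simp <;> grind
  exact (mul_eq_zero.1 key).resolve_left (sub_ne_zero.2 hij)

/-- A zero of f satisfies (𝕀Ω) × Ω = (`gyroForm`/`invForm`) ξ. The left side is nonzero, so the
coefficient can be inverted. -/
theorem exists_smul_gyro_of_drift_eq_zero {d : Vec} (hd : ∀ i, 0 < d i) {x : Ambient}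
    (hx : x.2 ≠ 0) (h : drift d x = 0) (hg : gyro d x.1 ≠ 0) :
    ∃ s : ℝ, x.2 = s • gyro d x.1 := by
  have hq := (invForm_pos hd hx).ne'
  have e : ∀ i, gyro d x.1 i = gyroForm d x * (invForm d x.2)⁻¹ * x.2 i := fun i => by
    have h1 : (drift d x).1 i = 0 := by rw [h]; rfl
    rw [drift_fst_apply hd hx] at h1
    have hi := (hd i).ne'
    have h2 : (d i)⁻¹ * (gyro d x.1 i - gyroForm d x * (invForm d x.2)⁻¹ * x.2 i) = 0 := by
      linear_combination h1
    exact sub_eq_zero.1 ((mul_eq_zero.1 h2).resolve_left (inv_ne_zero hi))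
  have hp : gyroForm d x * (invForm d x.2)⁻¹ ≠ 0 := fun h0 => hg (funext fun i => by
    rw [e, h0, zero_mul]; rfl)
  refine ⟨(gyroForm d x * (invForm d x.2)⁻¹)⁻¹, funext fun i => ?_⟩
  rw [Pi.smul_apply, e i, smul_eq_mul, inv_mul_cancel_left₀ hp]

theorem isOpen_drift_ne_zero {d : Vec} (hd : ∀ i, 0 < d i) :
    IsOpen {x : Ambient | x.2 ≠ 0 ∧ drift d x ≠ 0} :=
  (contDiffOn_drift hd).continuousOn.isOpen_inter_preimage isOpen_snd_ne_zero isOpen_ne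

/-! ### Three-parameter families that cover the zeros of the drift. -/

theorem exists_polar (a b : ℝ) :
    ∃ φ : ℝ, a = Real.sqrt (a ^ 2 + b ^ 2) * Real.cos φ ∧
      b = Real.sqrt (a ^ 2 + b ^ 2) * Real.sin φ := by
  refine ⟨Complex.arg ⟨a, b⟩, ?_, ?_⟩
  · have := Complex.norm_mul_cos_arg ⟨a, b⟩
    rw [Complex.norm_eq_sqrt_sq_add_sq] at this
    exact this.symm
  · have := Complex.norm_mul_sin_arg ⟨a, b⟩
    rw [Complex.norm_eq_sqrt_sq_add_sq] at this
    exact this.symm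

/-- Spherical coordinates on the energy ellipsoid. -/
def ellipsoidParam (d : Vec) (eS : ℝ) (θ φ : ℝ) : Vec :=
  ![Real.sqrt (2 * eS / d 0) * (Real.cos θ * Real.cos φ),
    Real.sqrt (2 * eS / d 1) * (Real.cos θ * Real.sin φ), Real.sqrt (2 * eS / d 2) * Real.sin θ]

theorem exists_ellipsoidParam {d : Vec} (hd : ∀ i, 0 < d i) {eS : ℝ} (heS : 0 < eS) {Ω : Vec}
    (h : energy d Ω = eS) : ∃ θ φ, Ω = ellipsoidParam d eS θ φ := by
  set r : Fin 3 → ℝ := fun i => Real.sqrt (2 * eS / d i) with hr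
  have hr0 : ∀ i, r i ≠ 0 := fun i => (Real.sqrt_pos.2 (div_pos (by positivity) (hd i))).ne'
  have hr2 : ∀ i, r i * r i * d i = 2 * eS := fun i => by
    rw [Real.mul_self_sqrt (div_pos (by positivity) (hd i)).le, div_mul_cancel₀ _ (hd i).ne']
  obtain ⟨n, hn⟩ : ∃ n : Vec, ∀ i, Ω i = r i * n i :=
    ⟨fun i => (r i)⁻¹ * Ω i, fun i => (mul_inv_cancel_left₀ (hr0 i) _).symm⟩
  have hs : n 0 ^ 2 + n 1 ^ 2 + n 2 ^ 2 = 1 := by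
    rw [energy_eq, hn, hn, hn] at h
    refine mul_left_cancel₀ heS.ne' ?_
    linear_combination h - n 0 ^ 2 / 2 * hr2 0 - n 1 ^ 2 / 2 * hr2 1 - n 2 ^ 2 / 2 * hr2 2
  obtain ⟨φ, h0, h1⟩ := exists_polar (n 0) (n 1)
  -- The latitude: cos θ is the distance of n from the polar axis, so it is the radius in the polar
  -- form for φ.
  obtain ⟨θ, h3, h4⟩ := exists_polar (Real.sqrt (n 0 ^ 2 + n 1 ^ 2)) (n 2)
  rw [Real.sq_sqrt (by positivity), hs, Real.sqrt_one, one_mul] at h3 h4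
  rw [h3] at h0 h1
  refine ⟨θ, φ, funext fun i => ?_⟩
  fin_cases i
  · exact (hn 0).trans (by rw [h0]; rfl)
  · exact (hn 1).trans (by rw [h1]; rfl)
  · exact (hn 2).trans (by rw [h4]; rfl)

/-- Parametrization of the states with `ξ` parallel to `(𝕀 Ω) × Ω`. -/
def gyroParam (d : Vec) (eS : ℝ) (p : ℝ × ℝ × ℝ) : Ambient :=
  (ellipsoidParam d eS p.1 p.2.1, p.2.2 • gyro d (ellipsoidParam d eS p.1 p.2.1))

/-- Parametrization of the states with `Ω i = 0`. -/
def planeParam (d : Vec) (eS : ℝ) (i : Fin 3) (p : ℝ × ℝ × ℝ) : Ambient :=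
  (Pi.single (i + 1) (Real.sqrt (2 * eS / d (i + 1)) * Real.cos p.1) +
      Pi.single (i + 2) (Real.sqrt (2 * eS / d (i + 2)) * Real.sin p.1),
    Pi.single i p.2.1 +
      p.2.2 • (Pi.single (i + 1) (-(Real.sqrt (2 * eS / d (i + 2)) * Real.sin p.1)) +
        Pi.single (i + 2) (Real.sqrt (2 * eS / d (i + 1)) * Real.cos p.1)))

theorem contDiff_ellipsoidParam (d : Vec) (eS : ℝ) :
    ContDiff ℝ 1 fun p : ℝ × ℝ × ℝ => ellipsoidParam d eS p.1 p.2.1 := by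
  rw [contDiff_pi]
  intro i
  fin_cases i <;> simp [ellipsoidParam] <;> fun_prop

theorem contDiff_gyroParam (d : Vec) (eS : ℝ) : ContDiff ℝ 1 (gyroParam d eS) := by
  have h := contDiff_ellipsoidParam d eS
  refine h.prodMk (contDiff_snd.snd.smul ?_)
  have hi := contDiff_pi.1 h
  simp only [gyro_eq]
  generalize (fun p : ℝ × ℝ × ℝ => ellipsoidParam d eS p.1 p.2.1) = f at *
  have h0 := hi 0
  have h1 := hi 1
  have h2 := hi 2
  rw [contDiff_pi]
  intro i
  fin_cases i <;> simp <;> fun_prop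

theorem contDiff_single {f : ℝ × ℝ × ℝ → ℝ} (hf : ContDiff ℝ 1 f) (i : Fin 3) :
    ContDiff ℝ 1 fun p => (Pi.single i (f p) : Vec) :=
  (ContinuousLinearMap.single ℝ (fun _ : Fin 3 => ℝ) i).contDiff.comp hf

theorem contDiff_planeParam (d : Vec) (eS : ℝ) (i : Fin 3) : ContDiff ℝ 1 (planeParam d eS i) := by
  refine ((contDiff_single ?_ _).add (contDiff_single ?_ _)).prodMk ((contDiff_single ?_ _).add
    (contDiff_snd.snd.smul ((contDiff_single ?_ _).add (contDiff_single ?_ _))))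
  all_goals fun_prop

/-- With Ω_i = 0, Ω is given by one angle on an ellipse. In ξ, the component along e_i is free, and
the other two components are orthogonal to a nonzero vector of the plane, hence a multiple of its
quarter turn. Indices are cyclic modulo 3. -/
theorem exists_planeParam {d : Vec} (hd : ∀ i, 0 < d i) {eS : ℝ} (heS : 0 < eS) {x : Ambient}
    (he : energy d x.1 = eS) (hxx : x.1 ⬝ᵥ x.2 = 0) {i : Fin 3} (hi : x.1 i = 0) :
    x ∈ range (planeParam d eS i) := by
  set r : Fin 3 → ℝ := fun i => Real.sqrt (2 * eS / d i) with hr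
  have hr0 : ∀ i, r i ≠ 0 := fun i => (Real.sqrt_pos.2 (div_pos (by positivity) (hd i))).ne'
  have hr2 : ∀ i, r i * r i * d i = 2 * eS := fun i => by
    rw [Real.mul_self_sqrt (div_pos (by positivity) (hd i)).le, div_mul_cancel₀ _ (hd i).ne']
  obtain ⟨n, hn⟩ : ∃ n : Vec, ∀ i, x.1 i = r i * n i :=
    ⟨fun i => (r i)⁻¹ * x.1 i, fun i => (mul_inv_cancel_left₀ (hr0 i) _).symm⟩
  have hs : n 0 ^ 2 + n 1 ^ 2 + n 2 ^ 2 = 1 := by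
    rw [energy_eq, hn, hn, hn] at he
    refine mul_left_cancel₀ heS.ne' ?_
    linear_combination he - n 0 ^ 2 / 2 * hr2 0 - n 1 ^ 2 / 2 * hr2 1 - n 2 ^ 2 / 2 * hr2 2
  have hni : n i = 0 := by
    rw [hn] at hi
    exact (mul_eq_zero.1 hi).resolve_left (hr0 i)
  obtain ⟨θ, h1, h2⟩ := exists_polar (n (i + 1)) (n (i + 2))
  have hs2 : n (i + 1) ^ 2 + n (i + 2) ^ 2 = 1 := by
    rw [← hs]
    fin_cases i <;> simp at hni ⊢ <;> simp [hni, add_comm]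
  rw [hs2, Real.sqrt_one, one_mul] at h1 h2
  have e1 : x.1 (i + 1) = r (i + 1) * Real.cos θ := by rw [hn, h1]
  have e2 : x.1 (i + 2) = r (i + 2) * Real.sin θ := by rw [hn, h2]
  have hD : x.1 (i + 1) * x.1 (i + 1) + x.1 (i + 2) * x.1 (i + 2) ≠ 0 := by
    intro h0
    have ha : x.1 (i + 1) = 0 := by nlinarith [mul_self_nonneg (x.1 (i + 2))]
    have hb : x.1 (i + 2) = 0 := by nlinarith [mul_self_nonneg (x.1 (i + 1))]
    rw [hn] at ha hb
    rw [(mul_eq_zero.1 ha).resolve_left (hr0 _), (mul_eq_zero.1 hb).resolve_left (hr0 _)] at hs2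
    norm_num at hs2
  have hdot : x.1 (i + 1) * x.2 (i + 1) + x.1 (i + 2) * x.2 (i + 2) = 0 := by
    rw [dot_eq] at hxx
    fin_cases i <;> simp at hi ⊢ <;> rw [hi] at hxx <;> linarith
  -- β is the coefficient of the planar part of ξ along the quarter turn of the planar part of Ω.
  obtain ⟨β, hβ⟩ : ∃ β, β * (x.1 (i + 1) * x.1 (i + 1) + x.1 (i + 2) * x.1 (i + 2)) =
      x.1 (i + 1) * x.2 (i + 2) - x.1 (i + 2) * x.2 (i + 1) := ⟨_, div_mul_cancel₀ _ hD⟩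
  have b1 : x.2 (i + 1) = β * -x.1 (i + 2) := by
    refine mul_right_cancel₀ hD ?_
    linear_combination x.1 (i + 1) * hdot + x.1 (i + 2) * hβ
  have b2 : x.2 (i + 2) = β * x.1 (i + 1) := by
    refine mul_right_cancel₀ hD ?_
    linear_combination x.1 (i + 2) * hdot - x.1 (i + 1) * hβ
  refine ⟨(θ, x.2 i, β), ?_⟩
  have hz : planeParam d eS i (θ, x.2 i, β) =
      (Pi.single (i + 1) (x.1 (i + 1)) + Pi.single (i + 2) (x.1 (i + 2)),
        Pi.single i (x.2 i) + β • (Pi.single (i + 1) (-x.1 (i + 2)) +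
          Pi.single (i + 2) (x.1 (i + 1)))) := by
    rw [e1, e2]
    rfl
  rw [hz]
  ext l
  · fin_cases i <;> fin_cases l <;> simp at hi ⊢ <;> simp [hi]
  · fin_cases i <;> fin_cases l <;> simp at b1 b2 ⊢ <;> simp [b1, b2]

/-- A C¹ map does not raise Hausdorff dimension, so the image of ℝ³ has dimension at most 3 < 4. -/
theorem hausdorffMeasure_range_eq_zero {f : ℝ × ℝ × ℝ → Ambient} (hf : ContDiff ℝ 1 f) :
    MeasureTheory.Measure.hausdorffMeasure 4 (range f) = 0 := by
  have h : dimH (range f) ≤ 3 := by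
    have := hf.dimH_range_le
    simpa [Module.finrank_prod, show (1 + (1 + 1) : ENNReal) = 3 by norm_num] using this
  have h4 : dimH (range f) < ((4 : NNReal) : ENNReal) := h.trans_lt (by norm_num)
  exact_mod_cast hausdorffMeasure_of_dimH_lt h4

theorem hausdorffMeasure_drift_eq_zero {d : Vec} (hd : ∀ i, 0 < d i) {eS : ℝ} (heS : 0 < eS)
    (h : ∃ i j, d i ≠ d j) :
    MeasureTheory.Measure.hausdorffMeasure 4
      {x ∈ (system d hd eS heS).state | drift d x = 0} = 0 := by
  obtain ⟨i, j, hij⟩ := h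
  refine MeasureTheory.measure_mono_null (t := range (gyroParam d eS) ∪
    (range (planeParam d eS i) ∪ range (planeParam d eS j))) ?_ ?_
  · rintro x ⟨hx, h0⟩
    obtain ⟨hx2, he, hxx⟩ := mem_state_iff.1 hx
    by_cases hg : gyro d x.1 = 0
    · rcases mul_eq_zero.1 (mul_eq_zero_of_gyro_eq_zero hg hij) with h1 | h1
      · exact Or.inr (Or.inl (exists_planeParam hd heS he hxx h1))
      · exact Or.inr (Or.inr (exists_planeParam hd heS he hxx h1))
    · obtain ⟨s, hs⟩ := exists_smul_gyro_of_drift_eq_zero hd hx2 h0 hg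
      obtain ⟨θ, φ, hΩ⟩ := exists_ellipsoidParam hd heS he
      refine Or.inl ⟨(θ, φ, s), Prod.ext hΩ.symm ?_⟩
      rw [hs, hΩ]
      rfl
  · rw [MeasureTheory.measure_union_null_iff, MeasureTheory.measure_union_null_iff]
    exact ⟨hausdorffMeasure_range_eq_zero (contDiff_gyroParam d eS),
      hausdorffMeasure_range_eq_zero (contDiff_planeParam d eS i),
      hausdorffMeasure_range_eq_zero (contDiff_planeParam d eS j)⟩

/-! ### Density of the set where the drift does not vanish -/

theorem dot_gyro (d Ω : Vec) : Ω ⬝ᵥ gyro d Ω = 0 := dot_cross_self _ _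

theorem energy_smul (d : Vec) (s : ℝ) (Ω : Vec) : energy d (s • Ω) = s ^ 2 * energy d Ω := by
  simp only [energy_eq, Pi.smul_apply, smul_eq_mul]
  ring

/-- Keep Ω and, at a zero of f, where ξ is parallel to (𝕀Ω) × Ω, push ξ along w = Ω × ((𝕀Ω) × Ω).
This stays orthogonal to Ω and destroys the parallelism, since w is orthogonal to (𝕀Ω) × Ω. -/
theorem mem_closure_drift_ne_zero_of_gyro_ne_zero {d : Vec} (hd : ∀ i, 0 < d i) {eS : ℝ}
    (heS : 0 < eS) {x : Ambient} (hx : x ∈ (system d hd eS heS).state) (hg : gyro d x.1 ≠ 0) :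
    x ∈ closure {x ∈ (system d hd eS heS).state | drift d x ≠ 0} := by
  obtain ⟨hx2, he, hxx⟩ := mem_state_iff.1 hx
  by_cases h0 : drift d x ≠ 0
  · exact subset_closure ⟨hx, h0⟩
  obtain ⟨s, hs⟩ := exists_smul_gyro_of_drift_eq_zero hd hx2 (not_not.1 h0) hg
  have hΩ := dot_self_eq_zero_iff.not.2 (ne_zero_of_energy heS he)
  have hGG := dot_self_eq_zero_iff.not.2 hg
  have hdg := dot_gyro d x.1
  set w : Vec := x.1 ⨯₃ gyro d x.1 with hw
  have hww : w ⬝ᵥ w ≠ 0 := by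
    rw [hw, cross_dot_cross, hdg, zero_mul, sub_zero]
    exact mul_ne_zero hΩ hGG
  have hwg : gyro d x.1 ⬝ᵥ w = 0 := dot_cross_self _ _
  have hwx : x.1 ⬝ᵥ w = 0 := dot_self_cross _ _
  have hc : Tendsto (fun ε : ℝ => ((x.1, x.2 + ε • w) : Ambient)) (𝓝[≠] 0) (𝓝 x) := by
    have : Continuous fun ε : ℝ => ((x.1, x.2 + ε • w) : Ambient) := by fun_prop
    simpa using (this.tendsto 0).mono_left nhdsWithin_le_nhds
  refine mem_closure_of_tendsto hc ?_
  filter_upwards [self_mem_nhdsWithin] with ε hε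
  have hkey : (x.2 + ε • w) ⬝ᵥ w ≠ 0 := by
    rw [add_dotProduct, smul_dotProduct, hs, smul_dotProduct, hwg, smul_zero, zero_add]
    exact mul_ne_zero hε hww
  have hne : x.2 + ε • w ≠ 0 := fun h => hkey (by rw [h, zero_dotProduct])
  refine ⟨mem_state_iff.2 ⟨hne, he, ?_⟩, fun hz => ?_⟩
  · rw [dotProduct_add, hxx, dotProduct_smul, hwx, smul_zero, add_zero]
  · obtain ⟨s', hs'⟩ := exists_smul_gyro_of_drift_eq_zero hd hne hz hg
    dsimp only at hs'
    exact hkey (by rw [hs', smul_dotProduct, hwg, smul_zero])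

/-- The point of the energy ellipsoid on the ray through `P`. -/
def normalize (d : Vec) (eS : ℝ) (P : Vec) : Vec := Real.sqrt (eS / energy d P) • P

theorem energy_normalize {d : Vec} (hd : ∀ i, 0 < d i) {eS : ℝ} (heS : 0 < eS) {P : Vec}
    (hP : P ≠ 0) : energy d (normalize d eS P) = eS := by
  have h := energy_pos hd hP
  rw [normalize, energy_smul, Real.sq_sqrt (by positivity), div_mul_cancel₀ _ h.ne']

theorem normalize_of_energy {d : Vec} {eS : ℝ} (heS : 0 < eS) {P : Vec} (hP : energy d P = eS) :
    normalize d eS P = P := by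
  rw [normalize, hP, div_self heS.ne', Real.sqrt_one, one_smul]

theorem continuous_energy (d : Vec) : Continuous (energy d) := by
  rw [funext (energy_eq d)]
  fun_prop

theorem continuousAt_normalize {d : Vec} (hd : ∀ i, 0 < d i) (eS : ℝ) {P : Vec} (hP : P ≠ 0) :
    ContinuousAt (normalize d eS) P :=
  (Real.continuous_sqrt.continuousAt.comp (continuousAt_const.div
    (continuous_energy d).continuousAt (energy_pos hd hP).ne')).smul continuousAt_id

/-- It suffices to approximate by states with (𝕀Ω) × Ω ≠ 0, which are already in the closure. Moving
Ω along (1, 1, 1) makes Ω_i and Ω_j both nonzero; Ω is then rescaled to the ellipsoid and ξ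
projected onto its orthogonal complement. -/
theorem state_subset_closure {d : Vec} (hd : ∀ i, 0 < d i) {eS : ℝ} (heS : 0 < eS)
    (h : ∃ i j, d i ≠ d j) :
    (system d hd eS heS).state ⊆
      closure {x ∈ (system d hd eS heS).state | drift d x ≠ 0} := by
  obtain ⟨i, j, hij⟩ := h
  intro x hx
  obtain ⟨hx2, he, hxx⟩ := mem_state_iff.1 hx
  have hΩ := ne_zero_of_energy heS he
  have hΩ2 := dot_self_eq_zero_iff.not.2 hΩ
  rw [← closure_closure]
  let P : ℝ → Vec := fun ε => x.1 + ε • fun _ => 1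
  let F : Vec → Ambient := fun y =>
    (normalize d eS y, x.2 - ((y ⬝ᵥ x.2) / (y ⬝ᵥ y)) • y)
  have hP : Continuous P := by fun_prop
  have hP0 : P 0 = x.1 := by simp [P]
  have hF0 : F x.1 = x := by
    simp [F, normalize_of_energy heS he, hxx]
  have hFc : ContinuousAt F x.1 := by
    have h1 : ContinuousAt (fun y : Vec => (y ⬝ᵥ x.2) / (y ⬝ᵥ y)) x.1 :=
      ContinuousAt.div₀ (continuous_id.dotProduct continuous_const).continuousAt
        (continuous_id.dotProduct continuous_id).continuousAt hΩ2
    exact (continuousAt_normalize hd eS hΩ).prodMk (continuousAt_const.sub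
      (h1.smul continuousAt_id))
  have hc : Tendsto (fun ε => F (P ε)) (𝓝[≠] 0) (𝓝 x) := by
    have h1 : Tendsto P (𝓝 0) (𝓝 x.1) := hP0 ▸ hP.tendsto 0
    have h2 : Tendsto F (𝓝 x.1) (𝓝 x) := by
      have := hFc.tendsto
      rwa [hF0] at this
    exact (h2.comp h1).mono_left nhdsWithin_le_nhds
  refine mem_closure_of_tendsto hc ?_
  have ev1 : ∀ k, ∀ᶠ ε in 𝓝[≠] (0 : ℝ), P ε k ≠ 0 := fun k => by
    by_cases hk : x.1 k = 0
    · filter_upwards [self_mem_nhdsWithin] with ε hε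
      simpa [P, hk] using hε
    · have : ContinuousAt (fun ε => P ε k) 0 := by fun_prop
      refine (this.eventually_ne (by simpa [P] using hk)).filter_mono nhdsWithin_le_nhds
  have ev2 := hc.eventually (isOpen_snd_ne_zero.mem_nhds hx2)
  filter_upwards [ev1 i, ev1 j, ev2] with ε hi hj h2
  have hPε : P ε ≠ 0 := fun h => hi (by rw [h]; rfl)
  have hPP := dot_self_eq_zero_iff.not.2 hPε
  refine mem_closure_drift_ne_zero_of_gyro_ne_zero hd heS
    (mem_state_iff.2 ⟨h2, energy_normalize hd heS hPε, ?_⟩) ?_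
  · simp only [F, normalize, smul_dotProduct, dotProduct_sub, dotProduct_smul, smul_eq_mul]
    rw [mul_left_comm, div_mul_cancel₀ _ hPP, sub_self]
  · intro hg
    have h4 := mul_eq_zero_of_gyro_eq_zero hg hij
    have h5 : Real.sqrt (eS / energy d (P ε)) ≠ 0 :=
      (Real.sqrt_pos.2 (div_pos heS (energy_pos hd hPε))).ne'
    exact mul_ne_zero (mul_ne_zero h5 hi) (mul_ne_zero h5 hj) h4

theorem state_nonempty {d : Vec} (hd : ∀ i, 0 < d i) {eS : ℝ} (heS : 0 < eS) :
    (system d hd eS heS).state.Nonempty := by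
  have h1 : (1 : Vec) ≠ 0 := one_ne_zero
  obtain ⟨ξ, hξ, h⟩ := exists_orthogonal_ne_zero (normalize d eS 1)
  exact ⟨(_, ξ), mem_state_iff.2 ⟨hξ, energy_normalize hd heS h1, h⟩⟩

theorem hasDrift {d : Vec} (hd : ∀ i, 0 < d i) {eS : ℝ} (heS : 0 < eS) (h : ∃ i j, d i ≠ d j) :
    (system d hd eS heS).HasDrift := by
  intro h0
  obtain ⟨x, hx⟩ := state_nonempty hd heS
  obtain ⟨y, hy, hy0⟩ := closure_nonempty_iff.1 ⟨x, state_subset_closure hd heS h hx⟩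
  exact hy0 (h0 y hy)

end Suslov

end

/-! ### Concatenation of controls and trajectories. -/

noncomputable section

namespace AffineControlSystem

open Set Filter Topology

variable {E F : Type*} [NormedAddCommGroup E] [NormedSpace ℝ E]
  [NormedAddCommGroup F] [NormedSpace ℝ F] {k : ℕ}

theorem isAdmissible_of_contDiffOn {r : WithTop ℕ∞} {a b : ℝ} (hab : a ≤ b)
    {u : ℝ → Fin k → ℝ} (hu : ContDiffOn ℝ r u (Icc a b)) : IsAdmissible r a b u := by
  refine ⟨1, fun j => if j = 0 then a else b, ?_, by simp, by simp, fun j hj => ?_⟩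
  · intro i j hij
    rcases Nat.eq_zero_or_pos i with rfl | hi
    · rcases Nat.eq_zero_or_pos j with rfl | hj
      · simp
      · simp [hj.ne', hab]
    · simp [hi.ne', (hi.trans_le hij).ne']
  · obtain rfl : j = 0 := by omega
    exact ⟨u, by simpa using hu, fun _ _ => rfl⟩

theorem IsAdmissible.concat {r : WithTop ℕ∞} {a b c : ℝ} {u v : ℝ → Fin k → ℝ}
    (hu : IsAdmissible r a b u) (hv : IsAdmissible r b c v) :
    IsAdmissible r a c (fun t => if t < b then u t else v t) := by
  obtain ⟨n, s, hs, s0, sn, hs'⟩ := hu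
  obtain ⟨m, t, ht, t0, tm, ht'⟩ := hv
  -- The two formulas for the nodes agree at j = n, as both give the junction time b.
  have e1 : ∀ j ≤ n, (if j < n then s j else t (j - n)) = s j := fun j hj => by
    rcases hj.lt_or_eq with h | rfl
    · simp [h]
    · simp [t0, sn]
  have e2 : ∀ j, n ≤ j → (if j < n then s j else t (j - n)) = t (j - n) := fun j hj =>
    if_neg hj.not_gt
  refine ⟨n + m, fun j => if j < n then s j else t (j - n), ?_, ?_, ?_, fun j hj => ?_⟩
  · refine monotone_nat_of_le_succ fun j => ?_
    rcases lt_or_ge j n with h | h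
    · rw [e1 j h.le, e1 (j + 1) h]
      exact hs j.le_succ
    · rw [e2 j h, e2 (j + 1) (h.trans j.le_succ)]
      exact ht (by omega)
  · exact (e1 0 n.zero_le).trans s0
  · dsimp only
    rw [e2 _ (Nat.le_add_right n m), Nat.add_sub_cancel_left, tm]
  · dsimp only
    rcases lt_or_ge j n with h | h
    · rw [e1 j h.le, e1 (j + 1) h]
      obtain ⟨w, hw, hw'⟩ := hs' j h
      refine ⟨w, hw, fun τ hτ => ?_⟩
      rw [← hw' hτ]
      exact if_pos (hτ.2.trans_le (sn ▸ hs h))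
    · rw [e2 j h, e2 (j + 1) (h.trans j.le_succ), Nat.sub_add_comm h]
      obtain ⟨w, hw, hw'⟩ := ht' (j - n) (by omega)
      refine ⟨w, hw, fun τ hτ => ?_⟩
      rw [← hw' hτ]
      exact if_neg ((t0 ▸ ht (Nat.zero_le (j - n)) : b ≤ t (j - n)).trans hτ.1.le).not_gt

theorem IsTrajectory.concat {S : AffineControlSystem E F k} {a b c : ℝ} (hab : a ≤ b)
    (hbc : b ≤ c) {u v : ℝ → Fin k → ℝ} {x y : ℝ → E} (hx : S.IsTrajectory a b u x)
    (hy : S.IsTrajectory b c v y) (hxy : x b = y b) :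
    S.IsTrajectory a c (fun t => if t < b then u t else v t)
      (fun t => if t < b then x t else y t) := by
  obtain ⟨cx, sx, N, hN⟩ := hx
  obtain ⟨cy, sy, N', hN'⟩ := hy
  have e1 : EqOn (fun t => if t < b then x t else y t) x (Icc a b) := fun t ht => by
    rcases ht.2.lt_or_eq with h | rfl
    · exact if_pos h
    · simp [hxy]
  have e2 : EqOn (fun t => if t < b then x t else y t) y (Icc b c) := fun t ht =>
    if_neg ht.1.not_gt
  -- The velocity may jump at the junction, so b joins the exceptional times.
  refine ⟨?_, fun t ht => ?_, insert b (N ∪ N'), fun t ht htN => ?_⟩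
  · rw [← Icc_union_Icc_eq_Icc hab hbc]
    exact (cx.congr e1).union_of_isClosed (cy.congr e2) isClosed_Icc isClosed_Icc
  · rcases le_total t b with h | h
    · exact e1 ⟨ht.1, h⟩ ▸ sx t ⟨ht.1, h⟩
    · exact e2 ⟨h, ht.2⟩ ▸ sy t ⟨h, ht.2⟩
  · simp only [Finset.mem_insert, Finset.mem_union, not_or] at htN
    rcases lt_or_gt_of_ne htN.1 with h | h
    · simp only [h, if_true]
      refine (hN t ⟨ht.1, h⟩ htN.2.1).congr_of_eventuallyEq ?_
      filter_upwards [Iio_mem_nhds h] with s hs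
      exact if_pos hs
    · simp only [h.not_gt, if_false]
      refine (hN' t ⟨h, ht.2⟩ htN.2.2).congr_of_eventuallyEq ?_
      filter_upwards [Ioi_mem_nhds h] with s hs
      exact if_neg (not_lt.2 (le_of_lt hs))

/-- For every initial time, `x` can be steered to `y` with controls that are piecewise of class
`C^r`. -/
def CanSteer (S : AffineControlSystem E F k) (r : WithTop ℕ∞) (x y : E) : Prop :=
  ∀ a : ℝ, ∃ b, a ≤ b ∧ ∃ (u : ℝ → Fin k → ℝ) (z : ℝ → E), IsAdmissible r a b u ∧
    S.IsTrajectory a b u z ∧ z a = x ∧ z b = y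

theorem CanSteer.trans {S : AffineControlSystem E F k} {r : WithTop ℕ∞} {x y z : E}
    (hxy : S.CanSteer r x y) (hyz : S.CanSteer r y z) : S.CanSteer r x z := by
  intro a
  obtain ⟨b, hab, u, p, hu, hp, pa, pb⟩ := hxy a
  obtain ⟨c, hbc, v, q, hv, hq, qb, qc⟩ := hyz b
  refine ⟨c, hab.trans hbc, _, _, hu.concat hv, hp.concat hab hbc hq (pb.trans qb.symm), ?_, ?_⟩
  · rcases hab.lt_or_eq with h | rfl
    · rw [if_pos h, pa]
    · rw [if_neg (lt_irrefl a), qb, ← pb, pa]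
  · rw [if_neg hbc.not_gt, qc]

end AffineControlSystem

namespace Suslov

open Set Filter Topology

/-! ### Trajectories determined by the angular velocity -/

/-- `𝕀 v - (𝕀 Ω) × Ω`. -/
def netTorque (d Ω v : Vec) : Vec := fun i => d i * v i - gyro d Ω i

theorem dot_netTorque {d Ω v : Vec} (h : Ω ⬝ᵥ (fun i => d i * v i) = 0) :
    Ω ⬝ᵥ netTorque d Ω v = 0 := by
  have : netTorque d Ω v = (fun i => d i * v i) - gyro d Ω := rfl
  rw [this, dotProduct_sub, h, dot_gyro, sub_zero]

/-- This is the derivative of the constant energy along the curve. -/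
theorem dot_inertia_deriv {d : Vec} {eS : ℝ} {Ω : ℝ → Vec} {v : Vec} {t : ℝ}
    (hΩ : HasDerivAt Ω v t) (he : ∀ᶠ s in 𝓝 t, energy d (Ω s) = eS) :
    Ω t ⬝ᵥ (fun i => d i * v i) = 0 := by
  have h := hasDerivAt_pi.1 hΩ
  have h1 := (((((h 0).const_mul (d 0)).mul (h 0)).add (((h 1).const_mul (d 1)).mul (h 1))).add
    (((h 2).const_mul (d 2)).mul (h 2))).const_mul (1 / 2)
  have h2 : HasDerivAt (fun s => energy d (Ω s)) 0 t :=
    (hasDerivAt_const t eS).congr_of_eventuallyEq he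
  simp only [energy_eq] at h2
  have h3 := h1.unique h2
  rw [dot_eq]
  linear_combination h3

theorem contDiffAt_netTorque {d : Vec} {Ω V : ℝ → Vec} {t : ℝ} (hΩ : ContDiffAt ℝ ω Ω t)
    (hV : ContDiffAt ℝ ω V t) : ContDiffAt ℝ ω (fun s => netTorque d (Ω s) (V s)) t := by
  have h := contDiffAt_pi.1 hΩ
  have h' := contDiffAt_pi.1 hV
  have h0 := h 0
  have h1 := h 1
  have h2 := h 2
  rw [contDiffAt_pi]
  intro i
  refine (contDiffAt_const.mul (h' i)).sub ?_
  simp only [gyro_eq]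
  fin_cases i <;> simp <;> fun_prop

theorem contDiffAt_deriv {Ω : ℝ → Vec} {t : ℝ} (hΩ : ContDiffAt ℝ ω Ω t) :
    ContDiffAt ℝ ω (deriv Ω) t :=
  (hΩ.analyticAt).deriv.contDiffAt

/-- Put ξ = 𝕀Ω' - (𝕀Ω) × Ω. Constant energy gives ⟨Ω, ξ⟩ = 0. The equations of motion reduce to a
scalar multiple of ξ whose coefficient is ⟨Ω', ξ⟩ + ⟨Ω, ξ'⟩, the derivative of ⟨Ω, ξ⟩, and so
vanishes. The control ξ' is analytic on [a, b], which serves every class r. -/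
theorem exists_trajectory_of_velocity {d : Vec} {hd : ∀ i, 0 < d i} {eS : ℝ} {heS : 0 < eS}
    {a b : ℝ} (hab : a ≤ b) (r : WithTop ℕ∞) {Ω V : ℝ → Vec}
    (hΩ : ∀ t ∈ Icc a b, ContDiffAt ℝ ω Ω t) (hV : ∀ t ∈ Icc a b, HasDerivAt Ω (V t) t)
    (he : ∀ t ∈ Icc a b, ∀ᶠ s in 𝓝 t, energy d (Ω s) = eS)
    (hm : ∀ t ∈ Icc a b, netTorque d (Ω t) (V t) ≠ 0) :
    ∃ (u : ℝ → Vec) (x : ℝ → Ambient), AffineControlSystem.IsAdmissible r a b u ∧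
      (system d hd eS heS).IsTrajectory a b u x ∧ x a = (Ω a, netTorque d (Ω a) (V a)) ∧
      x b = (Ω b, netTorque d (Ω b) (V b)) := by
  -- Using `deriv Ω` rather than `V`, about which only values on [a, b] are known, makes ξ analytic
  -- at the endpoints too.
  set ξ : ℝ → Vec := fun t => netTorque d (Ω t) (deriv Ω t) with hξ
  have eξ : ∀ t ∈ Icc a b, ξ t = netTorque d (Ω t) (V t) := fun t ht => by
    rw [hξ, ← (hV t ht).deriv]
  have sξ : ∀ t ∈ Icc a b, ContDiffAt ℝ ω ξ t := fun t ht =>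
    contDiffAt_netTorque (hΩ t ht) (contDiffAt_deriv (hΩ t ht))
  have hdot : ∀ t ∈ Icc a b, Ω t ⬝ᵥ ξ t = 0 := fun t ht => by
    rw [eξ t ht]
    exact dot_netTorque (dot_inertia_deriv (hV t ht) (he t ht))
  refine ⟨deriv ξ, fun t => (Ω t, ξ t), ?_, ⟨?_, fun t ht => ?_, ∅, fun t ht _ => ?_⟩, ?_, ?_⟩
  · exact AffineControlSystem.isAdmissible_of_contDiffOn hab fun t ht =>
      ((contDiffAt_deriv (sξ t ht)).of_le le_top).contDiffWithinAt
  · exact fun t ht => ((hΩ t ht).continuousAt.prodMk (sξ t ht).continuousAt).continuousWithinAt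
  · exact mem_state_iff.2 ⟨fun h => hm t ht ((eξ t ht).symm.trans h), (he t ht).self_of_nhds, hdot t ht⟩
  · have ht' := Ioo_subset_Icc_self ht
    have h1 := hV t ht'
    have h2 := ((sξ t ht').differentiableAt (by simp)).hasDerivAt
    have hne : ξ t ≠ 0 := fun h => hm t ht' ((eξ t ht').symm.trans h)
    have h3 := (residual_eq_zero_iff hd (Ω t) (V t) (ξ t) (deriv ξ t) hne).1 ?_
    · exact h3 ▸ h1.prodMk h2
    · have p1 := hasDerivAt_pi.1 h1
      have p2 := hasDerivAt_pi.1 h2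
      have h4 := (((p1 0).mul (p2 0)).add ((p1 1).mul (p2 1))).add ((p1 2).mul (p2 2))
      have h5 : HasDerivAt (fun s => Ω s ⬝ᵥ ξ s) 0 t :=
        (hasDerivAt_const t (0 : ℝ)).congr_of_eventuallyEq
          (Filter.eventually_of_mem (Icc_mem_nhds ht.1 ht.2) hdot)
      simp only [dot_eq] at h5
      have h6 := h4.unique h5
      have hξi : ∀ i, V t i = (d i)⁻¹ * (gyro d (Ω t) i + ξ t i) := fun i => by
        rw [eq_inv_mul_iff_mul_eq₀ (hd i).ne', eξ t ht', netTorque]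
        ring
      have h7 : invForm d (ξ t) + (Ω t ⬝ᵥ deriv ξ t +
          gyro d (Ω t) ⬝ᵥ ((inertia d)⁻¹ *ᵥ ξ t)) = 0 := by
        rw [invForm_eq hd, dot_eq, dot_eq]
        simp only [mulVec_inertia_inv hd]
        rw [hξi 0, hξi 1, hξi 2] at h6
        linear_combination h6
      funext i
      have h8 : residual d (Ω t) (V t) (ξ t) (deriv ξ t) i =
          (invForm d (ξ t) + (Ω t ⬝ᵥ deriv ξ t +
            gyro d (Ω t) ⬝ᵥ ((inertia d)⁻¹ *ᵥ ξ t))) * ξ t i := by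
        have e : d i * V t i - gyro d (Ω t) i = ξ t i := by rw [eξ t ht']; rfl
        simp only [residual, Pi.add_apply, Pi.smul_apply, Pi.sub_apply, smul_eq_mul,
          mulVec_inertia, e]
        ring
      rw [h8, h7, zero_mul]
      rfl
  · rw [← eξ a ⟨le_rfl, hab⟩]
  · rw [← eξ b ⟨hab, le_rfl⟩]

/-! ### Controllability without drift -/

/-- The Ω-velocity produced by a control u is proportional to ⟨Ω, u⟩, so u = η - ξ moves ξ along the
segment and leaves Ω fixed. -/
theorem canSteer_segment {d : Vec} {hd : ∀ i, 0 < d i} {eS : ℝ} {heS : 0 < eS}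
    (r : WithTop ℕ∞) (h0 : ∀ x, drift d x = 0) {Ω ξ η : Vec} (he : energy d Ω = eS)
    (hξ : Ω ⬝ᵥ ξ = 0) (hη : Ω ⬝ᵥ η = 0)
    (hne : ∀ t ∈ Icc (0 : ℝ) 1, ξ + t • (η - ξ) ≠ 0) :
    (system d hd eS heS).CanSteer r (Ω, ξ) (Ω, η) := by
  intro a
  refine ⟨a + 1, by linarith, fun _ => η - ξ, fun t => (Ω, ξ + (t - a) • (η - ξ)),
    AffineControlSystem.isAdmissible_of_contDiffOn (by linarith) contDiffOn_const,
    ⟨?_, fun t ht => ?_, ∅, fun t ht _ => ?_⟩, by simp, by simp⟩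
  · fun_prop
  · refine mem_state_iff.2 ⟨hne _ ⟨by linarith [ht.1], by linarith [ht.2]⟩, he, ?_⟩
    simp [dotProduct_add, dotProduct_smul, dotProduct_sub, hξ, hη]
  · have h1 : HasDerivAt (fun t : ℝ => ((Ω, ξ + (t - a) • (η - ξ)) : Ambient)) (0, η - ξ) t := by
      refine (hasDerivAt_const t Ω).prodMk ?_
      simpa using (((hasDerivAt_id t).sub_const a).smul_const (η - ξ)).const_add ξ
    refine h1.congr_deriv (Eq.symm ?_)
    change drift d _ + ∑ i, (η - ξ) i • control d i _ = _
    rw [h0, zero_add]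
    refine Prod.ext (funext fun i => ?_) (sum_control_snd d _ _)
    rw [sum_control_fst_apply hd]
    simp [dotProduct_sub, hξ, hη]

/-- If the segment from ξ to η meets 0, the two are parallel, and a detour through Ω × ξ, orthogonal
to both, avoids 0. -/
theorem canSteer_fiber {d : Vec} {hd : ∀ i, 0 < d i} {eS : ℝ} {heS : 0 < eS}
    (r : WithTop ℕ∞) (h0 : ∀ x, drift d x = 0) {Ω ξ η : Vec} (he : energy d Ω = eS)
    (hξ : Ω ⬝ᵥ ξ = 0) (hη : Ω ⬝ᵥ η = 0) (hξ0 : ξ ≠ 0) (hη0 : η ≠ 0) :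
    (system d hd eS heS).CanSteer r (Ω, ξ) (Ω, η) := by
  have hΩ := dot_self_eq_zero_iff.not.2 (ne_zero_of_energy heS he)
  by_cases h : ∀ t ∈ Icc (0 : ℝ) 1, ξ + t • (η - ξ) ≠ 0
  · exact canSteer_segment r h0 he hξ hη h
  push Not at h
  obtain ⟨s, hs, hs0⟩ := h
  set w : Vec := Ω ⨯₃ ξ with hw
  have hwΩ : Ω ⬝ᵥ w = 0 := dot_self_cross _ _
  have hξξ := dot_self_eq_zero_iff.not.2 hξ0
  have hηη := dot_self_eq_zero_iff.not.2 hη0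
  have hww : w ⬝ᵥ w ≠ 0 := by
    rw [hw, cross_dot_cross, hξ, zero_mul, sub_zero]
    exact mul_ne_zero hΩ hξξ
  have hwξ : w ⬝ᵥ ξ = 0 := by rw [dotProduct_comm]; exact dot_cross_self _ _
  have hwη : w ⬝ᵥ η = 0 := by
    have h1 : w ⬝ᵥ (ξ + s • (η - ξ)) = 0 := by rw [hs0, dotProduct_zero]
    rw [dotProduct_add, dotProduct_smul, dotProduct_sub, hwξ, zero_add, sub_zero] at h1
    refine (mul_eq_zero.1 h1).resolve_left ?_
    rintro rfl
    exact hξ0 (by simpa using hs0)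
  refine (canSteer_segment r h0 he hξ hwΩ fun t _ ht => ?_).trans
    (canSteer_segment r h0 he hwΩ hη fun t _ ht => ?_)
  · have h1 : w ⬝ᵥ (ξ + t • (w - ξ)) = 0 := by rw [ht, dotProduct_zero]
    rw [dotProduct_add, dotProduct_smul, dotProduct_sub, hwξ, zero_add, sub_zero] at h1
    rw [(mul_eq_zero.1 h1).resolve_right hww] at ht
    exact hξ0 (by simpa using ht)
  · have h1 : (w + t • (η - w)) ⬝ᵥ η = 0 := by rw [ht, zero_dotProduct]
    rw [add_dotProduct, smul_dotProduct, sub_dotProduct, hwη, zero_add, sub_zero] at h1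
    rw [(mul_eq_zero.1 h1).resolve_right hηη] at ht
    exact hww (by rw [show w = 0 by simpa using ht, dotProduct_zero])

/-- For 𝕀 = c I the gyroscopic term vanishes and ξ = c Ω'. The great circle from Ω with initial
velocity w is therefore the velocity part of a trajectory. -/
theorem canSteer_rotation {d : Vec} {hd : ∀ i, 0 < d i} {eS : ℝ} {heS : 0 < eS}
    (r : WithTop ℕ∞) {c : ℝ} (hc : ∀ i, d i = c) {Ω w : Vec}
    (he : energy d Ω = eS) (hw : energy d w = eS) (hΩw : Ω ⬝ᵥ w = 0) {θ : ℝ} (hθ : 0 ≤ θ) :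
    (system d hd eS heS).CanSteer r (Ω, c • w)
      (Real.cos θ • Ω + Real.sin θ • w, c • (-Real.sin θ • Ω + Real.cos θ • w)) := by
  intro a
  have hc0 : c ≠ 0 := hc 0 ▸ (hd 0).ne'
  have hnt : ∀ Ω v : Vec, netTorque d Ω v = c • v := fun Ω v => by
    funext i
    fin_cases i <;> simp [netTorque, gyro_eq, hc] <;> ring
  have hene : ∀ s, energy d (Real.cos s • Ω + Real.sin s • w) = eS := fun s => by
    rw [energy_eq] at *
    rw [dot_eq] at hΩw
    simp only [hc, Pi.add_apply, Pi.smul_apply, smul_eq_mul] at *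
    linear_combination Real.cos s ^ 2 * he + Real.sin s ^ 2 * hw +
      eS * Real.cos_sq_add_sin_sq s + c * Real.cos s * Real.sin s * hΩw
  have hV : ∀ t, HasDerivAt (fun t => Real.cos (t - a) • Ω + Real.sin (t - a) • w)
      (-Real.sin (t - a) • Ω + Real.cos (t - a) • w) t := fun t => by
    have h1 : HasDerivAt (fun t => t - a) 1 t := (hasDerivAt_id t).sub_const a
    refine HasDerivAt.congr_deriv ((h1.cos.smul_const Ω).add (h1.sin.smul_const w)) ?_
    simp
  have hne : ∀ t, netTorque d (Real.cos (t - a) • Ω + Real.sin (t - a) • w)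
      (-Real.sin (t - a) • Ω + Real.cos (t - a) • w) ≠ 0 := fun t => by
    rw [hnt]
    refine smul_ne_zero hc0 fun h => ne_zero_of_energy heS hw ?_
    have h1 : (-Real.sin (t - a) • Ω + Real.cos (t - a) • w) ⬝ᵥ Ω = 0 := by
      rw [h, zero_dotProduct]
    have h2 : (-Real.sin (t - a) • Ω + Real.cos (t - a) • w) ⬝ᵥ w = 0 := by
      rw [h, zero_dotProduct]
    rw [add_dotProduct, smul_dotProduct, smul_dotProduct, dotProduct_comm w, hΩw, smul_zero,
      add_zero] at h1
    rw [add_dotProduct, smul_dotProduct, smul_dotProduct, hΩw, smul_zero, zero_add] at h2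
    by_contra hw0
    have h3 := (mul_eq_zero.1 h1).resolve_right
      (dot_self_eq_zero_iff.not.2 (ne_zero_of_energy heS he))
    have h4 := (mul_eq_zero.1 h2).resolve_right (dot_self_eq_zero_iff.not.2 hw0)
    have h5 := Real.sin_sq_add_cos_sq (t - a)
    rw [h4, neg_eq_zero.1 h3] at h5
    norm_num at h5
  obtain ⟨u, x, hu, hx, xa, xb⟩ := exists_trajectory_of_velocity (d := d) (hd := hd) (heS := heS)
    (by linarith : a ≤ a + θ) r (Ω := fun t => Real.cos (t - a) • Ω + Real.sin (t - a) • w)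
    (V := fun t => -Real.sin (t - a) • Ω + Real.cos (t - a) • w)
    (fun t _ => by fun_prop) (fun t _ => hV t) (fun t _ => .of_forall fun s => hene _)
    (fun t _ => hne t)
  refine ⟨a + θ, by linarith, u, x, hu, hx, ?_, ?_⟩
  · rw [xa, hnt]; simp
  · rw [xb, hnt]; simp

theorem exists_rotation {d : Vec} {eS : ℝ} (heS : 0 < eS) {c : ℝ} (hc : ∀ i, d i = c)
    {Ω Ω' : Vec} (he : energy d Ω = eS) (he' : energy d Ω' = eS) :
    ∃ (w : Vec) (θ : ℝ), 0 ≤ θ ∧ energy d w = eS ∧ Ω ⬝ᵥ w = 0 ∧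
      Ω' = Real.cos θ • Ω + Real.sin θ • w := by
  have hen : ∀ v : Vec, energy d v = c / 2 * (v ⬝ᵥ v) := fun v => by
    rw [energy_eq, dot_eq, hc, hc, hc]
    ring
  have hΩ : 0 < Ω ⬝ᵥ Ω := by
    have := dot_self_eq_zero_iff.not.2 (ne_zero_of_energy heS he)
    refine lt_of_le_of_ne ?_ (Ne.symm this)
    rw [dot_eq]
    nlinarith [mul_self_nonneg (Ω 0), mul_self_nonneg (Ω 1), mul_self_nonneg (Ω 2)]
  have hc0 : c ≠ 0 := by
    rintro rfl
    rw [hen] at he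
    simp at he
    exact heS.ne he
  have hΩ' : Ω' ⬝ᵥ Ω' = Ω ⬝ᵥ Ω := by
    rw [hen] at he he'
    exact mul_left_cancel₀ (div_ne_zero hc0 two_ne_zero) (he'.trans he.symm)
  -- κ is the cosine of the angle between Ω and Ω'. When κ² = 1 they are parallel, and any
  -- orthogonal direction serves for w.
  obtain ⟨κ, hκ⟩ : ∃ κ, κ * (Ω ⬝ᵥ Ω) = Ω ⬝ᵥ Ω' := ⟨_, div_mul_cancel₀ _ hΩ.ne'⟩
  set z : Vec := Ω' - κ • Ω with hz
  have hzz : z ⬝ᵥ z = (1 - κ ^ 2) * (Ω ⬝ᵥ Ω) := by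
    simp only [hz, dotProduct_sub, sub_dotProduct, dotProduct_smul, smul_dotProduct, smul_eq_mul,
      dotProduct_comm Ω' Ω, hΩ', ← hκ]
    ring
  have hΩz : Ω ⬝ᵥ z = 0 := by
    rw [hz, dotProduct_sub, dotProduct_smul, smul_eq_mul, hκ, sub_self]
  have hz0 : 0 ≤ z ⬝ᵥ z := by
    rw [dot_eq]
    nlinarith [mul_self_nonneg (z 0), mul_self_nonneg (z 1), mul_self_nonneg (z 2)]
  have hκ1 : 0 ≤ 1 - κ ^ 2 := by
    rw [hzz] at hz0
    exact nonneg_of_mul_nonneg_left hz0 hΩ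
  have hκ2 := abs_le.1 (abs_le_one_iff_mul_self_le_one.2 (by nlinarith : κ * κ ≤ 1))
  have hcos := Real.cos_arccos hκ2.1 hκ2.2
  have hsin := Real.sin_arccos κ
  rcases hκ1.eq_or_lt with h | h
  · obtain ⟨v, hv, hΩv⟩ := exists_orthogonal_ne_zero Ω
    have hvv : 0 < v ⬝ᵥ v := by
      refine lt_of_le_of_ne ?_ (Ne.symm (dot_self_eq_zero_iff.not.2 hv))
      rw [dot_eq]
      nlinarith [mul_self_nonneg (v 0), mul_self_nonneg (v 1), mul_self_nonneg (v 2)]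
    refine ⟨Real.sqrt ((Ω ⬝ᵥ Ω) / (v ⬝ᵥ v)) • v, Real.arccos κ, Real.arccos_nonneg κ, ?_, ?_, ?_⟩
    · rw [energy_smul, Real.sq_sqrt (by positivity), hen, ← he, hen]
      field_simp
    · rw [dotProduct_smul, hΩv, smul_zero]
    · have : z = 0 := dot_self_eq_zero_iff.1 (by rw [hzz, ← h, zero_mul])
      rw [hcos, hsin, ← h, Real.sqrt_zero, zero_smul, add_zero]
      exact sub_eq_zero.1 this
  · have hs := Real.sqrt_pos.2 h
    refine ⟨(Real.sqrt (1 - κ ^ 2))⁻¹ • z, Real.arccos κ, Real.arccos_nonneg κ, ?_, ?_, ?_⟩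
    · rw [energy_smul, inv_pow, Real.sq_sqrt h.le, hen, hzz, ← he, hen]
      field_simp
    · rw [dotProduct_smul, hΩz, smul_zero]
    · rw [hcos, hsin, smul_inv_smul₀ hs.ne', hz]
      abel

theorem isControllable {d : Vec} {hd : ∀ i, 0 < d i} {eS : ℝ} {heS : 0 < eS} {c : ℝ}
    (hc : ∀ i, d i = c) (r : WithTop ℕ∞) (a : ℝ) :
    (system d hd eS heS).IsControllable r a := by
  rintro ⟨Ω, ξ⟩ hx ⟨Ω', ξ'⟩ hy
  obtain ⟨hξ, he, hΩξ⟩ := mem_state_iff.1 hx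
  obtain ⟨hξ', he', hΩξ'⟩ := mem_state_iff.1 hy
  dsimp only at hξ he hΩξ hξ' he' hΩξ'
  obtain ⟨w, θ, hθ, hw, hΩw, hrot⟩ := exists_rotation heS hc he he'
  have hc0 : c ≠ 0 := hc 0 ▸ (hd 0).ne'
  have h0 := drift_eq_zero_of_eq hc
  have h1 : (system d hd eS heS).CanSteer r (Ω, ξ) (Ω, c • w) :=
    canSteer_fiber r h0 he hΩξ (by rw [dotProduct_smul, hΩw, smul_zero]) hξ
      (smul_ne_zero hc0 (ne_zero_of_energy heS hw))
  have h2 := canSteer_rotation (hd := hd) (heS := heS) r hc he hw hΩw hθ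
  rw [← hrot] at h2
  -- Run the rotation once only to learn that its endpoint lies in M, as the last move within the
  -- fibre requires.
  obtain ⟨b, hab, u, z, hu, hz, hza, hzb⟩ := h2 0
  obtain ⟨k1, -, k3⟩ := mem_state_iff.1 (hz.2.1 b ⟨hab, le_rfl⟩)
  rw [hzb] at k1 k3
  exact ((h1.trans h2).trans (canSteer_fiber r h0 he' k3 hΩξ' k1 hξ')) a

end Suslov

end

noncomputable section

namespace Suslov

open Set Filter Topology

/-! ### Accessibility -/

/-- The bilinear form `⟨𝕀 P, P'⟩` relative to `2 * energy d P`. -/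
def radialRate (d P P' : Vec) : ℝ :=
  (d 0 * P 0 * P' 0 + d 1 * P 1 * P' 1 + d 2 * P 2 * P' 2) / (2 * energy d P)

/-- The velocity of `normalize d eS ∘ P` for a curve `P` with velocity `P'`. -/
def normalizeVelocity (d : Vec) (eS : ℝ) (P P' : Vec) : Vec :=
  Real.sqrt (eS / energy d P) • (P' - radialRate d P P' • P)

theorem hasDerivAt_energy {d : Vec} {P : ℝ → Vec} {P' : Vec} {t : ℝ} (h : HasDerivAt P P' t) :
    HasDerivAt (fun s => energy d (P s))
      (d 0 * P t 0 * P' 0 + d 1 * P t 1 * P' 1 + d 2 * P t 2 * P' 2) t := by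
  have hi := hasDerivAt_pi.1 h
  have h1 := (((((hi 0).const_mul (d 0)).mul (hi 0)).add
    (((hi 1).const_mul (d 1)).mul (hi 1))).add
    (((hi 2).const_mul (d 2)).mul (hi 2))).const_mul (1 / 2)
  simp only [energy_eq]
  refine h1.congr_deriv ?_
  ring

theorem hasDerivAt_normalize {d : Vec} (hd : ∀ i, 0 < d i) {eS : ℝ} (heS : 0 < eS)
    {P : ℝ → Vec} {P' : Vec} {t : ℝ} (h : HasDerivAt P P' t) (h0 : P t ≠ 0) :
    HasDerivAt (fun s => normalize d eS (P s)) (normalizeVelocity d eS (P t) P') t := by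
  have hE := energy_pos hd h0
  have hq : 0 < eS / energy d (P t) := div_pos heS hE
  have h1 := ((hasDerivAt_const t eS).div (hasDerivAt_energy (d := d) h) hE.ne').sqrt hq.ne'
  refine (h1.smul h).congr_deriv ?_
  have hs := Real.sq_sqrt hq.le
  have hs0 := Real.sqrt_pos.2 hq
  simp only [Pi.div_apply, normalizeVelocity, radialRate]
  generalize Real.sqrt (eS / energy d (P t)) = s at *
  have hs' : eS = s ^ 2 * energy d (P t) := by rw [hs, div_mul_cancel₀ _ hE.ne']
  rw [hs', smul_sub, smul_smul, sub_eq_add_neg (s • P'), ← neg_smul]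
  congr 2
  field_simp
  ring

theorem contDiff_energy (d : Vec) : ContDiff ℝ ω (energy d) := by
  rw [funext (energy_eq d)]
  fun_prop

theorem contDiffAt_normalize {d : Vec} (hd : ∀ i, 0 < d i) {eS : ℝ} (heS : 0 < eS) {P : Vec}
    (hP : P ≠ 0) : ContDiffAt ℝ ω (normalize d eS) P := by
  have hE := energy_pos hd hP
  exact ((contDiffAt_const.div (contDiff_energy d).contDiffAt hE.ne').sqrt
    (div_pos heS hE).ne').smul contDiffAt_id

theorem continuousAt_netTorque_normalize {d : Vec} (hd : ∀ i, 0 < d i) (eS : ℝ)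
    {p : Vec × Vec} (hp : p.1 ≠ 0) :
    ContinuousAt (fun p : Vec × Vec =>
      netTorque d (normalize d eS p.1) (normalizeVelocity d eS p.1 p.2)) p := by
  have hE := (energy_pos hd hp).ne'
  have c1 : Continuous fun p : Vec × Vec => energy d p.1 := (continuous_energy d).comp continuous_fst
  have c2 : ContinuousAt (fun p : Vec × Vec => normalize d eS p.1) p :=
    (continuousAt_normalize hd eS hp).comp continuousAt_fst
  have c3 : ContinuousAt (fun p : Vec × Vec => radialRate d p.1 p.2) p := by
    refine ContinuousAt.div₀ ?_ (continuousAt_const.mul c1.continuousAt) (by positivity)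
    fun_prop
  have c4 : ContinuousAt (fun p : Vec × Vec => normalizeVelocity d eS p.1 p.2) p :=
    ((Real.continuous_sqrt.continuousAt.comp
      (continuousAt_const.div₀ c1.continuousAt hE))).smul
      (continuousAt_snd.sub (c3.smul continuousAt_fst))
  have c2i := continuousAt_pi.1 c2
  have h0 := c2i 0
  have h1 := c2i 1
  have h2 := c2i 2
  refine continuousAt_pi.2 fun i => (continuousAt_const.mul (continuousAt_pi.1 c4 i)).sub ?_
  simp only [gyro_eq]
  fin_cases i <;> simp <;> fun_prop

theorem isOpen_netTorque_normalize_ne_zero {d : Vec} (hd : ∀ i, 0 < d i) (eS : ℝ) :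
    IsOpen {p : Vec × Vec | p.1 ≠ 0 ∧
      netTorque d (normalize d eS p.1) (normalizeVelocity d eS p.1 p.2) ≠ 0} := by
  have h1 : IsOpen {p : Vec × Vec | p.1 ≠ 0} := isOpen_ne_fun continuous_fst continuous_const
  have h2 : ContinuousOn (fun p : Vec × Vec =>
      netTorque d (normalize d eS p.1) (normalizeVelocity d eS p.1 p.2)) {p | p.1 ≠ 0} :=
    fun p hp => (continuousAt_netTorque_normalize hd eS hp).continuousWithinAt
  exact h2.isOpen_inter_preimage h1 isOpen_ne

theorem normalize_smul {d : Vec} {eS : ℝ} (heS : 0 < eS) {κ : ℝ} (hκ : 0 < κ)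
    {Ω : Vec} (he : energy d Ω = eS) : normalize d eS (κ • Ω) = Ω := by
  rw [normalize, energy_smul, he, div_mul_cancel_right₀ heS.ne', Real.sqrt_inv,
    Real.sqrt_sq hκ.le, inv_smul_smul₀ hκ.ne']

/-- Radial projection undoes the scaling by κ and discards the radial velocity μκΩ. Hence κ and μ
are free choices when a state is lifted to ℝ³. -/
theorem normalizeVelocity_smul {d : Vec} {eS : ℝ} (heS : 0 < eS) {κ μ : ℝ}
    (hκ : 0 < κ) {Ω v : Vec} (he : energy d Ω = eS) (hv : Ω ⬝ᵥ (fun i => d i * v i) = 0) :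
    normalizeVelocity d eS (κ • Ω) (κ • v + μ • κ • Ω) = v := by
  have hrate : radialRate d (κ • Ω) (κ • v + μ • κ • Ω) = μ := by
    rw [radialRate, energy_smul, he, div_eq_iff (by positivity)]
    rw [energy_eq] at he
    rw [dot_eq] at hv
    simp only [Pi.smul_apply, Pi.add_apply, smul_eq_mul]
    linear_combination κ ^ 2 * hv + 2 * μ * κ ^ 2 * he
  rw [normalizeVelocity, hrate, energy_smul, he, div_mul_cancel_right₀ heS.ne', Real.sqrt_inv,
    Real.sqrt_sq hκ.le, add_sub_cancel_right, inv_smul_smul₀ hκ.ne']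

/-- The velocity `𝕀⁻¹ ((𝕀 Ω) × Ω + ξ)`. -/
def torqueVelocity (d : Vec) (x : Ambient) : Vec := fun i => (d i)⁻¹ * (gyro d x.1 i + x.2 i)

theorem netTorque_torqueVelocity {d : Vec} (hd : ∀ i, 0 < d i) (x : Ambient) :
    netTorque d x.1 (torqueVelocity d x) = x.2 := by
  funext i
  rw [netTorque, torqueVelocity, mul_inv_cancel_left₀ (hd i).ne', add_sub_cancel_left]

theorem torqueVelocity_netTorque {d : Vec} (hd : ∀ i, 0 < d i) (Ω v : Vec) :
    torqueVelocity d (Ω, netTorque d Ω v) = v := by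
  funext i
  change (d i)⁻¹ * (gyro d Ω i + (d i * v i - gyro d Ω i)) = v i
  rw [add_sub_cancel, inv_mul_cancel_left₀ (hd i).ne']

theorem dot_torqueVelocity {d : Vec} (hd : ∀ i, 0 < d i) {x : Ambient} (h : x.1 ⬝ᵥ x.2 = 0) :
    x.1 ⬝ᵥ (fun i => d i * torqueVelocity d x i) = 0 := by
  have : (fun i => d i * torqueVelocity d x i) = gyro d x.1 + x.2 := funext fun i =>
    mul_inv_cancel_left₀ (hd i).ne' _
  rw [this, dotProduct_add, dot_gyro, h, add_zero]

theorem continuous_torqueVelocity (d : Vec) : Continuous (torqueVelocity d) := by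
  refine continuous_pi fun i => continuous_const.mul (Continuous.add ?_ (by fun_prop))
  simp only [gyro_eq]
  fin_cases i <;> simp <;> fun_prop

/-- The cubic curve that agrees to first order with `p + (t - a) v` at `a` and that has value
`p + (c - a) v + δ` and derivative `v + δ'` at `c`. -/
def hermite (a c : ℝ) (p v δ δ' : Vec) (t : ℝ) : Vec :=
  p + (t - a) • v + (t - a) ^ 2 • (((c - a) ^ 2)⁻¹ • δ +
    (t - c) • (((c - a) ^ 2)⁻¹ • (δ' - (2 * (c - a)⁻¹) • δ)))

/-- The derivative of `hermite`. -/
def hermiteDeriv (a c : ℝ) (v δ δ' : Vec) (t : ℝ) : Vec :=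
  v + (2 * (t - a)) • (((c - a) ^ 2)⁻¹ • δ +
    (t - c) • (((c - a) ^ 2)⁻¹ • (δ' - (2 * (c - a)⁻¹) • δ))) +
    (t - a) ^ 2 • (((c - a) ^ 2)⁻¹ • (δ' - (2 * (c - a)⁻¹) • δ))

theorem hasDerivAt_hermite (a c : ℝ) (p v δ δ' : Vec) (t : ℝ) :
    HasDerivAt (hermite a c p v δ δ') (hermiteDeriv a c v δ δ' t) t := by
  have h1 : HasDerivAt (fun t => t - a) 1 t := (hasDerivAt_id t).sub_const a
  have h2 : HasDerivAt (fun t => t - c) 1 t := (hasDerivAt_id t).sub_const c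
  refine HasDerivAt.congr_deriv (((h1.smul_const v).const_add p).add ((h1.pow 2).smul
    ((h2.smul_const (((c - a) ^ 2)⁻¹ • (δ' - (2 * (c - a)⁻¹) • δ))).const_add
      (((c - a) ^ 2)⁻¹ • δ)))) ?_
  simp [hermiteDeriv]
  abel

theorem hermite_left (a c : ℝ) (p v δ δ' : Vec) : hermite a c p v δ δ' a = p := by
  simp [hermite]

theorem hermiteDeriv_left (a c : ℝ) (v δ δ' : Vec) : hermiteDeriv a c v δ δ' a = v := by
  simp [hermiteDeriv]

theorem hermite_right {a c : ℝ} (hac : a < c) (p v δ δ' : Vec) :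
    hermite a c p v δ δ' c = p + (c - a) • v + δ := by
  have h : (c - a) ^ 2 ≠ 0 := pow_ne_zero 2 (sub_pos.2 hac).ne'
  simp [hermite, smul_inv_smul₀ h]

theorem hermiteDeriv_right {a c : ℝ} (hac : a < c) (v δ δ' : Vec) :
    hermiteDeriv a c v δ δ' c = v + δ' := by
  have h0 := (sub_pos.2 hac).ne'
  funext i
  simp only [hermiteDeriv, Pi.add_apply, Pi.smul_apply, Pi.sub_apply, smul_eq_mul]
  field_simp
  ring

theorem hermite_zero (a c : ℝ) (p v : Vec) (t : ℝ) : hermite a c p v 0 0 t = p + (t - a) • v := by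
  simp [hermite]

theorem hermiteDeriv_zero (a c : ℝ) (v : Vec) (t : ℝ) : hermiteDeriv a c v 0 0 t = v := by
  simp [hermiteDeriv]

/-- Follow the radial projection of a straight line in ℝ³ for a short time, up to a state y₀. A
state y near y₀ lifts to a position and velocity near those of the line's end, and the Hermite cubic
with these end data is C¹-close to the line. Its projection thus still has ξ ≠ 0 and is a trajectory
from x that ends at y at the same time c. -/
theorem isAccessible {d : Vec} {hd : ∀ i, 0 < d i} {eS : ℝ} {heS : 0 < eS}
    (r : WithTop ℕ∞) (a : ℝ) : (system d hd eS heS).IsAccessible r a := by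
  intro x hx b hab
  obtain ⟨hξ, he, hdot⟩ := mem_state_iff.1 hx
  set v := torqueVelocity d x with hv
  set G := {p : Vec × Vec | p.1 ≠ 0 ∧
    netTorque d (normalize d eS p.1) (normalizeVelocity d eS p.1 p.2) ≠ 0} with hG
  have hGo : IsOpen G := isOpen_netTorque_normalize_ne_zero hd eS
  have hΩ := ne_zero_of_energy heS he
  have hNa : normalize d eS x.1 = x.1 := normalize_of_energy heS he
  have hVa : normalizeVelocity d eS x.1 v = v := by
    simpa using normalizeVelocity_smul (μ := 0) heS one_pos he (dot_torqueVelocity hd hdot)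
  have hTa : netTorque d x.1 v = x.2 := netTorque_torqueVelocity hd x
  -- the unperturbed curve
  obtain ⟨c, hac, hcb, hc⟩ : ∃ c, a < c ∧ c ≤ b ∧ ∀ t ∈ Icc a c, (x.1 + (t - a) • v, v) ∈ G := by
    have hcont : ContinuousAt (fun t : ℝ => ((x.1 + (t - a) • v, v) : Vec × Vec)) a := by fun_prop
    have hmem : (x.1 + (a - a) • v, v) ∈ G := by
      rw [sub_self, zero_smul, add_zero]
      refine ⟨hΩ, ?_⟩
      dsimp only
      rwa [hNa, hVa, hTa]
    obtain ⟨ε, hε, hball⟩ := Metric.eventually_nhds_iff.1 (hcont.eventually (hGo.mem_nhds hmem))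
    refine ⟨min b (a + ε / 2), lt_min hab (by linarith), min_le_left _ _, fun t ht => hball ?_⟩
    rw [Real.dist_eq, abs_of_nonneg (by linarith [ht.1])]
    linarith [ht.2.trans (min_le_right _ _)]
  set P := x.1 + (c - a) • v with hP
  obtain ⟨hP0, hPt⟩ : (P, v) ∈ G := hc c ⟨hac.le, le_rfl⟩
  dsimp only at hP0 hPt
  have hs : 0 < Real.sqrt (eS / energy d P) := Real.sqrt_pos.2 (div_pos heS (energy_pos hd hP0))
  -- κ and μ are the scale and radial rate of the line at its end, so that y₀ lifts to exactly (P,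
  -- v) and its cubic is the line itself.
  set κ := (Real.sqrt (eS / energy d P))⁻¹ with hκd
  have hκ : 0 < κ := inv_pos.2 hs
  set μ := radialRate d P v with hμ
  set Q : Ambient → Vec := fun y => κ • y.1 with hQ
  set Q' : Ambient → Vec := fun y => κ • torqueVelocity d y + μ • κ • y.1 with hQ'
  set y₀ : Ambient := (normalize d eS P,
    netTorque d (normalize d eS P) (normalizeVelocity d eS P v)) with hy₀
  have hQ0 : Q y₀ = P := inv_smul_smul₀ hs.ne' P
  have hQ0' : Q' y₀ = v := by
    have e : μ • κ • y₀.1 = μ • P := congrArg (μ • ·) hQ0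
    rw [hQ']
    dsimp only
    rw [e, hy₀, torqueVelocity_netTorque hd, normalizeVelocity, hκd, inv_smul_smul₀ hs.ne',
      sub_add_cancel]
  have hQc : Continuous Q := continuous_fst.const_smul κ
  have hQc' : Continuous Q' := ((continuous_torqueVelocity d).const_smul κ).add
    ((continuous_fst.const_smul κ).const_smul μ)
  -- the curve that ends at `y`
  set R : Ambient → ℝ → Vec := fun y => hermite a c x.1 v (Q y - P) (Q' y - v) with hR
  set R' : Ambient → ℝ → Vec := fun y => hermiteDeriv a c v (Q y - P) (Q' y - v) with hR'
  have hRc : Continuous fun z : Ambient × ℝ => (R z.1 z.2, R' z.1 z.2) := by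
    simp only [hR, hR', hermite, hermiteDeriv]
    fun_prop
  have hnear : ∀ᶠ y in 𝓝 y₀, ∀ t ∈ Icc a c, (R y t, R' y t) ∈ G := by
    -- Tube lemma: `G` is open and the interval compact, so one neighbourhood of y₀ works for all
    -- times.
    refine isCompact_Icc.eventually_forall_of_forall_eventually fun t ht => ?_
    refine hRc.continuousAt.eventually (hGo.mem_nhds ?_)
    simp only [hR, hR', hQ0, hQ0', sub_self, hermite_zero, hermiteDeriv_zero]
    exact hc t ht
  obtain ⟨W, hW, hWo, hWy⟩ := eventually_nhds_iff.1 hnear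
  have hdP : normalize d eS P ⬝ᵥ (fun i => d i * normalizeVelocity d eS P v i) = 0 := by
    -- With zero corrections this is just a line through P with velocity v; its projection has
    -- constant energy, which gives tangency at y₀.
    have h1 := hasDerivAt_hermite a c P v 0 0 a
    rw [hermiteDeriv_left] at h1
    have h2 : hermite a c P v 0 0 a = P := hermite_left ..
    have h3 := hasDerivAt_normalize hd heS h1 (by rwa [h2])
    have h4 := dot_inertia_deriv (d := d) (eS := eS) h3 ?_
    · rwa [h2] at h4
    · filter_upwards [h1.continuousAt.eventually_ne (by rwa [h2] : _ ≠ (0 : Vec))] with s hs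
      exact energy_normalize hd heS hs
  refine ⟨W, hWo, ⟨y₀, hWy, mem_state_iff.2
    ⟨hPt, energy_normalize hd heS hP0, dot_netTorque hdP⟩⟩, ?_⟩
  rintro y ⟨hyW, hy⟩
  obtain ⟨-, hye, hydot⟩ := mem_state_iff.1 hy
  have hRG := hW y hyW
  have hRd : ∀ t, HasDerivAt (R y) (R' y t) t := fun t => hasDerivAt_hermite ..
  have hRs : ContDiff ℝ ω (R y) := by
    change ContDiff ℝ ω fun t => hermite a c x.1 v (Q y - P) (Q' y - v) t
    simp only [hermite]
    fun_prop
  obtain ⟨u, z, hu, hz, hza, hzc⟩ := exists_trajectory_of_velocity (d := d) (hd := hd)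
    (heS := heS) hac.le r (Ω := fun t => normalize d eS (R y t))
    (V := fun t => normalizeVelocity d eS (R y t) (R' y t))
    (fun t ht => (contDiffAt_normalize hd heS (hRG t ht).1).fun_comp t hRs.contDiffAt)
    (fun t ht => hasDerivAt_normalize hd heS (hRd t) (hRG t ht).1)
    (fun t ht => ((hRd t).continuousAt.eventually_ne (hRG t ht).1).mono fun s hs =>
      energy_normalize hd heS hs)
    (fun t ht => (hRG t ht).2)
  refine mem_iUnion₂.2 ⟨c, ⟨hac.le, hcb⟩, hy, u, z, hu, hz, ?_, ?_⟩
  · rw [hza]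
    simp only [hR, hR', hermite_left, hermiteDeriv_left, hNa, hVa, hTa]
  · have e1 : R y c = κ • y.1 := by
      simp only [hR]
      rw [hermite_right hac, ← hP, add_sub_cancel]
    have e2 : R' y c = κ • torqueVelocity d y + μ • κ • y.1 := by
      simp only [hR']
      rw [hermiteDeriv_right hac, add_sub_cancel]
    rw [hzc, e1, e2, normalize_smul heS hκ hye,
      normalizeVelocity_smul heS hκ hye (dot_torqueVelocity hd hydot),
      netTorque_torqueVelocity hd]

end Suslov

end

theorem mainTheorem1 (d : Fin 3 → ℝ) (hd : ∀ i, 0 < d i) (eS : ℝ) (heS : 0 < eS) :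
    -- for `ξ ≠ 0` the equations of motion `q = 0` are the affine control system with `u = ξ'`
    (∀ Ω Ω' ξ ξ' : Fin 3 → ℝ, ξ ≠ 0 →
      (Suslov.residual d Ω Ω' ξ ξ' = 0 ↔
        (Ω', ξ') = Suslov.drift d (Ω, ξ) + ∑ i, ξ' i • Suslov.control d i (Ω, ξ))) ∧
    -- the accessibility distribution is the whole tangent space, which has dimension 4
    (∀ x ∈ (Suslov.system d hd eS heS).state,
      Module.finrank ℝ ((Suslov.system d hd eS heS).tangentSpace x) = 4 ∧
      (Suslov.system d hd eS heS).accessibilityDistribution x =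
        (Suslov.system d hd eS heS).tangentSpace x ∧
      Module.finrank ℝ ((Suslov.system d hd eS heS).accessibilityDistribution x) = 4) ∧
    -- inertia matrix proportional to the identity
    (∀ c : ℝ, 0 < c → Suslov.inertia d = c • (1 : Matrix (Fin 3) (Fin 3) ℝ) →
      Suslov.velocities d hd eS heS = Metric.sphere 0 (Real.sqrt (2 * eS / c)) ∧
      (∀ x ∈ (Suslov.system d hd eS heS).state, Suslov.drift d x = 0) ∧
      (Suslov.system d hd eS heS).IsDriftless ∧
      ∀ (r : WithTop ℕ∞) (a : ℝ), (r = ∞ ∨ r = ω) →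
        (Suslov.system d hd eS heS).IsControllable r a) ∧
    -- inertia matrix not proportional to the identity
    ((∀ c : ℝ, 0 < c → Suslov.inertia d ≠ c • (1 : Matrix (Fin 3) (Fin 3) ℝ)) →
      (Suslov.velocities d hd eS heS = {v | Suslov.energy d v.ofLp = eS} ∧
        ∀ (p : EuclideanSpace ℝ (Fin 3)) (ρ : ℝ),
          Suslov.velocities d hd eS heS ≠ Metric.sphere p ρ) ∧
      (∃ W : Set Suslov.Ambient, IsOpen W ∧
        W ∩ (Suslov.system d hd eS heS).state =
          {x ∈ (Suslov.system d hd eS heS).state | Suslov.drift d x ≠ 0}) ∧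
      ((Suslov.system d hd eS heS).state ⊆
        closure {x ∈ (Suslov.system d hd eS heS).state | Suslov.drift d x ≠ 0}) ∧
      MeasureTheory.Measure.hausdorffMeasure 4
        {x ∈ (Suslov.system d hd eS heS).state | Suslov.drift d x = 0} = 0 ∧
      (Suslov.system d hd eS heS).HasDrift ∧
      ∀ (r : WithTop ℕ∞) (a : ℝ), (r = ∞ ∨ r = ω) →
        (Suslov.system d hd eS heS).IsAccessible r a) := by
  refine ⟨fun Ω Ω' ξ ξ' hξ => Suslov.residual_eq_zero_iff hd Ω Ω' ξ ξ' hξ, fun x hx => ?_,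
    fun c hc hI => ?_, fun hI => ?_⟩
  · have h := Suslov.finrank_tangentSpace hx
    have h' := Suslov.accessibilityDistribution_eq hx
    exact ⟨h, h', h' ▸ h⟩
  · have hdc := Suslov.inertia_eq_smul_one_iff.1 hI
    have h0 := Suslov.drift_eq_zero_of_eq hdc
    exact ⟨Suslov.velocities_eq_sphere hd heS hc hdc, fun x _ => h0 x, fun x _ => h0 x,
      fun r a _ => Suslov.isControllable hdc r a⟩
  · have hne := Suslov.exists_ne_of_inertia_ne hd hI
    refine ⟨⟨Suslov.velocities_eq d hd eS heS, fun p ρ h => ?_⟩,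
      ⟨_, Suslov.isOpen_drift_ne_zero hd, ?_⟩, Suslov.state_subset_closure hd heS hne,
      Suslov.hausdorffMeasure_drift_eq_zero hd heS hne, Suslov.hasDrift hd heS hne,
      fun r a _ => Suslov.isAccessible r a⟩
    · obtain ⟨i, j, hij⟩ := hne
      exact hij (Suslov.eq_of_velocities_eq_sphere hd heS h i j)
    · ext x
      exact ⟨fun h => ⟨h.2, h.1.2⟩, fun h => ⟨⟨h.1.1, h.2⟩, h.1⟩⟩
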